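/- Let $s \in [0,\infty)$. In the complex Hilbert space $L^2((0,\pi);dx)$ let $T_{s,\min}$ be the closure of the operator $-\frac{d^2}{dx^2} + \frac{s^2-(1/4)}{\sin^2(x)}$ defined on $C_0^\infty((0,\pi))$, the smooth complex-valued functions with compact support contained in $(0,\pi)$. Then $T_{s,\min}$ is densely defined, symmetric and bounded from below, so that its Friedrichs extension $T_{s,F}$ exists: this is the restriction of $T_{s,\min}^*$ to those $f \in \mathrm{dom}(T_{s,\min}^*)$ for which there is a sequence $(u_n)_{n}$ in $\mathrm{dom}(T_{s,\min})$ with $\|u_n - f\| \to 0$ as $n \to \infty$ and $(u_n-u_m, T_{s,\min}(u_n-u_m)) \to 0$ as $n,m\to\infty$. The operator $T_{s,F}$ is self-adjoint, and its spectrum is $$\sigma(T_{s,F}) = \big\{[(1/2)+s+n]^2 \,\big|\, n \in \mathbb{N}_0\big\}.$$ The spectrum is purely discrete, that is, every point of $\sigma(T_{s,F})$ is an isolated point of $\sigma(T_{s,F})$ and an eigenvalue of finite multiplicity; and it is simple, that is, every eigenspace $\ker(T_{s,F}-\lambda)$, $\lambda \in \sigma(T_{s,F})$, is one-dimensional. In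 particular, $$\inf \sigma(T_{s,F}) = [(1/2)+s]^2.$$ -/

import Mathlib

open MeasureTheory Filter Set
open scoped Topology ContDiff

namespace PoschlTeller

section Abstract

variable {H : Type*} [NormedAddCommGroup H] [InnerProductSpace ℂ H]

/-- `S` is densely defined, symmetric and bounded from below. -/
def IsSemibounded (S : H →ₗ.[ℂ] H) : Prop :=
  Dense (S.domain : Set H) ∧ S.IsFormalAdjoint S ∧
    ∃ γ : ℝ, ∀ f : S.domain, γ * ‖(f : H)‖ ^ 2 ≤ (inner ℂ (f : H) (S f)).re

/-- The form domain of `S`: limits `f` in `H` of sequences `u n` in the domain of `S` for which the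
quadratic form satisfies `⟨u n - u m, S (u n - u m)⟩ → 0` as `n, m → ∞`. -/
def formDomain (S : H →ₗ.[ℂ] H) : Set H :=
  {f | ∃ u : ℕ → S.domain, Tendsto (fun n => (u n : H)) atTop (𝓝 f) ∧
    Tendsto (fun p : ℕ × ℕ =>
      (inner ℂ ((u p.1 - u p.2 : S.domain) : H) (S (u p.1 - u p.2))).re) atTop (𝓝 0)}

/-- For a semibounded operator the form domain is a linear subspace. -/
theorem coe_span_formDomain {S : H →ₗ.[ℂ] H} (hS : IsSemibounded S) :
    (Submodule.span ℂ (formDomain S) : Set H) = formDomain S := by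
  obtain ⟨-, -, γ, hγ⟩ := hS
  have hC : ∀ {f : H} {u : ℕ → S.domain}, Tendsto (fun n => (u n : H)) atTop (𝓝 f) →
      Tendsto (fun p : ℕ × ℕ => ‖((u p.1 - u p.2 : S.domain) : H)‖ ^ 2) atTop (𝓝 0) := by
    intro f u hu
    rw [← prod_atTop_atTop_eq]
    have h := ((hu.comp tendsto_fst).sub (hu.comp tendsto_snd) :
      Tendsto _ ((atTop : Filter ℕ) ×ˢ (atTop : Filter ℕ)) _)
    simpa using (h.norm.pow 2)
  let W : Submodule ℂ H :=
    { carrier := formDomain S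
      zero_mem' := ⟨fun _ => 0, by simp, by simp⟩
      add_mem' := by
        rintro f g ⟨u, hu, hu'⟩ ⟨v, hv, hv'⟩
        have hA := hC hu
        have hB := hC hv
        have hAB := hC (u := fun n => u n + v n) (f := f + g) (by simpa using hu.add hv)
        refine ⟨fun n => u n + v n, by simpa using hu.add hv, ?_⟩
        have key : ∀ a b : S.domain,
            (inner ℂ ((a + b : S.domain) : H) (S (a + b))).re ≤
              2 * (inner ℂ (a : H) (S a)).re + 2 * (inner ℂ (b : H) (S b)).re
                - γ * (2 * ‖(a : H)‖ ^ 2 + 2 * ‖(b : H)‖ ^ 2 - ‖((a + b : S.domain) : H)‖ ^ 2) := by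
          intro a b
          have h1 := hγ (a - b)
          have h2 := parallelogram_law_with_norm ℂ (a : H) (b : H)
          have h3 : ‖((a - b : S.domain) : H)‖ ^ 2 =
              2 * ‖(a : H)‖ ^ 2 + 2 * ‖(b : H)‖ ^ 2 - ‖((a + b : S.domain) : H)‖ ^ 2 := by
            simp only [Submodule.coe_sub, Submodule.coe_add]
            nlinarith
          rw [h3] at h1
          have h4 : (inner ℂ ((a - b : S.domain) : H) (S (a - b))).re =
              2 * (inner ℂ (a : H) (S a)).re + 2 * (inner ℂ (b : H) (S b)).re
                - (inner ℂ ((a + b : S.domain) : H) (S (a + b))).re := by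
            simp only [Submodule.coe_sub, Submodule.coe_add, LinearPMap.map_sub, LinearPMap.map_add,
              inner_sub_left, inner_sub_right, inner_add_left, inner_add_right, Complex.sub_re,
              Complex.add_re]
            ring
          linarith
        have hre : ∀ p : ℕ × ℕ, (u p.1 + v p.1) - (u p.2 + v p.2) =
            (u p.1 - u p.2) + (v p.1 - v p.2) := fun p => by abel
        refine tendsto_of_tendsto_of_tendsto_of_le_of_le (g := fun p : ℕ × ℕ =>
            γ * ‖(((u p.1 + v p.1) - (u p.2 + v p.2) : S.domain) : H)‖ ^ 2)
          (h := fun p : ℕ × ℕ =>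
            2 * (inner ℂ ((u p.1 - u p.2 : S.domain) : H) (S (u p.1 - u p.2))).re
              + 2 * (inner ℂ ((v p.1 - v p.2 : S.domain) : H) (S (v p.1 - v p.2))).re
              - γ * (2 * ‖((u p.1 - u p.2 : S.domain) : H)‖ ^ 2
                + 2 * ‖((v p.1 - v p.2 : S.domain) : H)‖ ^ 2
                - ‖(((u p.1 + v p.1) - (u p.2 + v p.2) : S.domain) : H)‖ ^ 2))
          (by simpa using hAB.const_mul γ) ?_ (fun p => hγ _) (fun p => ?_)
        · simpa using ((hu'.const_mul 2).add (hv'.const_mul 2)).sub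
            ((((hA.const_mul 2).add (hB.const_mul 2)).sub hAB).const_mul γ)
        · have := key (u p.1 - u p.2) (v p.1 - v p.2)
          simp only [hre]
          exact this
      smul_mem' := by
        rintro c f ⟨u, hu, hu'⟩
        refine ⟨fun n => c • u n, by simpa using hu.const_smul c, ?_⟩
        have h : ∀ a b : S.domain, (inner ℂ ((c • a - c • b : S.domain) : H)
            (S (c • a - c • b))).re =
              ‖c‖ ^ 2 * (inner ℂ ((a - b : S.domain) : H) (S (a - b))).re := by
          intro a b
          rw [← smul_sub, LinearPMap.map_smul, Submodule.coe_smul, inner_smul_left,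
            inner_smul_right, ← mul_assoc, ← Complex.normSq_eq_conj_mul_self, Complex.re_ofReal_mul,
            Complex.normSq_eq_norm_sq]
        simp only [h]
        simpa only [mul_zero] using hu'.const_mul (‖c‖ ^ 2) }
  exact congrArg (fun V : Submodule ℂ H => (V : Set H)) (Submodule.span_eq W)

/-- The Friedrichs extension of a semibounded operator `S`: the restriction of the adjoint `S†` to
the elements of its domain that lie in the form domain of `S`. The span only serves to make the
definition meaningful for every `S`: for semibounded `S` it is the form domain itself,
by `coe_span_formDomain`. -/
noncomputable def friedrichsExtension [CompleteSpace H] (S : H →ₗ.[ℂ] H) : H →ₗ.[ℂ] H :=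
  S.adjoint.domRestrict (Submodule.span ℂ (formDomain S))

/-- `z` is in the resolvent set if `T - z` maps the domain of `T` bijectively onto `H`
with bounded inverse `R`. -/
def resolventSet (T : H →ₗ.[ℂ] H) : Set ℂ :=
  {z | ∃ R : H →L[ℂ] H,
    (∀ g : H, ∃ f : T.domain, (f : H) = R g ∧ T f - z • (f : H) = g) ∧
    ∀ f : T.domain, R (T f - z • (f : H)) = f}

/-- The spectrum, the complement of the resolvent set. -/
def spectrum (T : H →ₗ.[ℂ] H) : Set ℂ := (resolventSet T)ᶜ

/-- The eigenspace `ker (T - z)`, that is, all `f` in the domain of `T` with `T f = z • f`. -/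
def eigenspace (T : H →ₗ.[ℂ] H) (z : ℂ) : Submodule ℂ H :=
  T.graph.comap (LinearMap.prod LinearMap.id (z • LinearMap.id))

theorem mem_eigenspace_iff {T : H →ₗ.[ℂ] H} {z : ℂ} {f : H} :
    f ∈ eigenspace T z ↔ ∃ h : f ∈ T.domain, T ⟨f, h⟩ = z • f := by
  simp [eigenspace, LinearPMap.mem_graph_iff]

/-- The discrete spectrum (of a self-adjoint operator): the isolated points of the spectrum that are
eigenvalues of finite multiplicity. -/
def discreteSpectrum (T : H →ₗ.[ℂ] H) : Set ℂ :=
  {z | (∃ U ∈ 𝓝 z, spectrum T ∩ U = {z}) ∧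
    eigenspace T z ≠ ⊥ ∧ FiniteDimensional ℂ (eigenspace T z)}

end Abstract

/-- The Hilbert space `L²((0,π); dx)` of complex-valued functions. -/
abbrev L2 : Type := Lp ℂ 2 (volume.restrict (Ioo (0 : ℝ) Real.pi))

/-- The differential expression `τ_s = -d²/dx² + (s² - 1/4) / sin² x`. -/
noncomputable def tau (s : ℝ) (φ : ℝ → ℂ) (x : ℝ) : ℂ :=
  -deriv (deriv φ) x + (((s ^ 2 - 1 / 4) / Real.sin x ^ 2 : ℝ) : ℂ) * φ x

/-- Smooth functions with compact support contained in `(0,π)`. -/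
def IsTestFunction (φ : ℝ → ℂ) : Prop :=
  ContDiff ℝ ∞ φ ∧ HasCompactSupport φ ∧ tsupport φ ⊆ Ioo 0 Real.pi

theorem IsTestFunction.hasDerivs {φ : ℝ → ℂ} (h : IsTestFunction φ) :
    Differentiable ℝ φ ∧ Differentiable ℝ (deriv φ) := by
  have h1 : ContDiff ℝ ∞ (deriv φ) := ((contDiff_infty_iff_deriv).1 h.1).2
  exact ⟨h.1.differentiable (by simp), h1.differentiable (by simp)⟩

/-- The graph of `τ_s` restricted to the test functions, in `L²((0,π)) × L²((0,π))`. -/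
noncomputable def preminimalGraph (s : ℝ) : Submodule ℂ (L2 × L2) where
  carrier := {p | ∃ φ : ℝ → ℂ, IsTestFunction φ ∧
    p.1 =ᵐ[volume.restrict (Ioo (0 : ℝ) Real.pi)] φ ∧
    p.2 =ᵐ[volume.restrict (Ioo (0 : ℝ) Real.pi)] tau s φ}
  zero_mem' := by
    refine ⟨0, ⟨contDiff_const, HasCompactSupport.zero, by simp⟩, Lp.coeFn_zero _ _ _, ?_⟩
    have h : tau s 0 = 0 := by
      funext x
      have h1 : deriv (0 : ℝ → ℂ) = 0 := by funext y; simp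
      simp [tau, h1]
    rw [h]
    exact Lp.coeFn_zero _ _ _
  add_mem' := by
    rintro p q ⟨φ, hφ, hp1, hp2⟩ ⟨ψ, hψ, hq1, hq2⟩
    refine ⟨φ + ψ, ⟨hφ.1.add hψ.1, hφ.2.1.add hψ.2.1, (tsupport_add φ ψ).trans
      (union_subset hφ.2.2 hψ.2.2)⟩, (Lp.coeFn_add _ _).trans (hp1.add hq1), ?_⟩
    have h : tau s (φ + ψ) = tau s φ + tau s ψ := by
      have h1 : deriv (φ + ψ) = deriv φ + deriv ψ :=
        funext fun x => deriv_add (hφ.hasDerivs.1 x) (hψ.hasDerivs.1 x)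
      funext x
      simp only [tau, Pi.add_apply, h1, deriv_add (hφ.hasDerivs.2 x) (hψ.hasDerivs.2 x)]
      ring
    rw [h]
    exact (Lp.coeFn_add _ _).trans (hp2.add hq2)
  smul_mem' := by
    rintro c p ⟨φ, hφ, hp1, hp2⟩
    refine ⟨c • φ, ⟨hφ.1.const_smul c, hφ.2.1.smul_left (f := fun _ => c),
      (closure_mono (Function.support_const_smul_subset c φ)).trans hφ.2.2⟩,
      (Lp.coeFn_smul _ _).trans (hp1.const_smul c), ?_⟩
    have h : tau s (c • φ) = c • tau s φ := by
      have h1 : deriv (c • φ) = c • deriv φ :=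
        funext fun x => deriv_const_smul c (hφ.hasDerivs.1 x)
      funext x
      simp only [tau, Pi.smul_apply, h1, deriv_const_smul c (hφ.hasDerivs.2 x), smul_eq_mul]
      ring
    rw [h]
    exact (Lp.coeFn_smul _ _).trans (hp2.const_smul c)

/-- The operator `τ_s` on the test functions `C_0^∞((0,π))`, acting in `L²((0,π))`. -/
noncomputable def preminimal (s : ℝ) : L2 →ₗ.[ℂ] L2 := (preminimalGraph s).toLinearPMap

/-- The relation `preminimalGraph s` is single-valued, so it is the graph of `preminimal s`. -/
theorem graph_preminimal (s : ℝ) : (preminimal s).graph = preminimalGraph s := by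
  refine Submodule.toLinearPMap_graph_eq _ ?_
  rintro ⟨f, g⟩ ⟨φ, hφ, hf, hg⟩ h0
  have h1 : φ =ᵐ[volume.restrict (Ioo (0 : ℝ) Real.pi)] (0 : ℝ → ℂ) := by
    have h0' : f = 0 := h0
    subst h0'
    exact hf.symm.trans (Lp.coeFn_zero _ _ _)
  have h2 : EqOn φ 0 (Ioo 0 Real.pi) :=
    Measure.eqOn_open_of_ae_eq h1 isOpen_Ioo hφ.1.continuous.continuousOn
      continuous_zero.continuousOn
  have h3 : φ = 0 := by
    funext x
    by_cases hx : x ∈ Ioo 0 Real.pi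
    · exact h2 hx
    · exact image_eq_zero_of_notMem_tsupport fun h => hx (hφ.2.2 h)
  have h4 : tau s φ = 0 := by
    funext x
    have h5 : deriv (0 : ℝ → ℂ) = 0 := by funext y; simp
    simp [tau, h3, h5]
  rw [h4] at hg
  exact (Lp.eq_zero_iff_ae_eq_zero).2 hg

/-- The minimal operator `T_{s,min}`, the closure of `τ_s` on the test functions. -/
noncomputable def minimalOperator (s : ℝ) : L2 →ₗ.[ℂ] L2 := (preminimal s).closure

/-- The Friedrichs extension `T_{s,F}` of the minimal operator. -/
noncomputable def friedrichsOperator (s : ℝ) : L2 →ₗ.[ℂ] L2 :=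
  friedrichsExtension (minimalOperator s)

end PoschlTeller

/-!
Write `c = 1/2 + s`, so that `s² - 1/4 = c² - c`. On test functions the expression factorizes as
`τ_s = A* A + c²` with `A = d/dx - c cot x` (`integral_conj_mul_tau`), which gives the lower bound
`c²` of the minimal operator and identifies its quadratic form as `‖A φ‖² + c² ‖φ‖²`.

The functions `sin^c x · P(cos x)`, with `P` a polynomial, are mapped by `τ_s` to
`sin^c x · (c² P + L P)(cos x)`, where `L P = (2c+1) X P' - (1 - X²) P''` is the Gegenbauer operator
(`hasDerivAt_sinPowDeriv`). `L` is triangular in the monomials with diagonal entries `n (n + 2c)`,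
so it has a monic eigenvector of each degree `n` (`exists_gegenbauer`), and
`c² + n (n + 2c) = (c + n)²`. The resulting functions `u_n` are eigenvectors of the adjoint of the
minimal operator by Green's formula, and they are total in `L²((0,π))` by the Weierstrass theorem
(`eq_zero_of_forall_integral_sinPow`). They belong to the form domain: `A u_n` is bounded, and the
cutoffs `χ_ε = H (sin^ε x)` satisfy `∫ |χ_ε'|² sin x dx = O(ε)`, which is enough since `2c ≥ 1`
(`sinPow_mem_formDomain`). In the borderline case `2c = 1`, rescaled linear cutoffs would not make
this integral tend to zero.

On the abstract side, the Friedrichs extension of a semibounded operator is symmetric and closed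
(`friedrichsExtension_isFormalAdjoint`, `friedrichsExtension_isClosed`), because each element of its
domain is approximated in the form sense by elements of the original domain
(`exists_tendsto_form`). A closed symmetric operator with a Hilbert basis of eigenvectors is
self-adjoint, and if the eigenvalues are distinct and tend to infinity, they make up the spectrum,
each being isolated and simple (`IsEigenbasis`).
-/

namespace PoschlTeller

/-! ### Closures of semibounded operators -/

section Abstract

variable {H : Type*} [NormedAddCommGroup H] [InnerProductSpace ℂ H] [CompleteSpace H]

theorem IsSemibounded.isClosable {S : H →ₗ.[ℂ] H} (hS : IsSemibounded S) : S.IsClosable :=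
  (LinearPMap.adjoint_isClosed hS.1).isClosable.leIsClosable (hS.2.1.le_adjoint hS.1)

/-- A closed condition on pairs `(x, S x)` passes from an operator to its closure. -/
theorem IsSemibounded.closure_induction {S : H →ₗ.[ℂ] H} (hS : IsSemibounded S)
    {C : Set (H × H)} (hC : IsClosed C) (h : ∀ x : S.domain, ((x : H), S x) ∈ C)
    (x : S.closure.domain) : ((x : H), S.closure x) ∈ C := by
  have h1 : ((x : H), S.closure x) ∈ S.graph.topologicalClosure := by
    rw [hS.isClosable.graph_closure_eq_closure_graph]
    exact LinearPMap.mem_graph _ x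
  refine closure_minimal ?_ hC h1
  rintro ⟨a, b⟩ hab
  obtain ⟨y, hy⟩ := (LinearPMap.mem_graph_iff' S).1 hab
  exact hy ▸ h y

/-- The adjoint of an operator is also adjoint to its closure. -/
theorem IsSemibounded.inner_closure_eq {S : H →ₗ.[ℂ] H} (hS : IsSemibounded S) {f w : H}
    (h : ∀ x : S.domain, inner ℂ w (x : H) = inner ℂ f (S x)) (x : S.closure.domain) :
    inner ℂ w (x : H) = inner ℂ f (S.closure x) :=
  hS.closure_induction (C := {p | inner ℂ w p.1 = inner ℂ f p.2})
    (isClosed_eq (by fun_prop) (by fun_prop)) h x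

theorem IsSemibounded.closure {S : H →ₗ.[ℂ] H} (hS : IsSemibounded S) :
    IsSemibounded S.closure := by
  refine ⟨hS.1.mono S.le_closure.1, fun x y => ?_, ?_⟩
  · refine hS.inner_closure_eq (fun z => ?_) y
    have h1 := hS.inner_closure_eq (f := z) (w := S z) (fun y => hS.2.1 z y) x
    rw [← inner_conj_symm, ← h1, inner_conj_symm]
  · obtain ⟨γ, hγ⟩ := hS.2.2
    exact ⟨γ, hS.closure_induction (C := {p | γ * ‖p.1‖ ^ 2 ≤ (inner ℂ p.1 p.2).re})
      (isClosed_le (by fun_prop) (by fun_prop)) hγ⟩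

/-! ### The Friedrichs extension -/

theorem mem_domain_friedrichsExtension {S : H →ₗ.[ℂ] H} (hS : IsSemibounded S) {f : H} :
    f ∈ (friedrichsExtension S).domain ↔ f ∈ formDomain S ∧ f ∈ S.adjoint.domain := by
  have : f ∈ formDomain S ↔ f ∈ Submodule.span ℂ (formDomain S) := by
    rw [← SetLike.mem_coe, coe_span_formDomain hS]
  rw [this]
  rfl

theorem friedrichsExtension_apply {S : H →ₗ.[ℂ] H} (f : (friedrichsExtension S).domain)
    (g : S.adjoint.domain) (h : (f : H) = g) : friedrichsExtension S f = S.adjoint g :=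
  LinearPMap.domRestrict_apply h

theorem inner_friedrichsExtension {S : H →ₗ.[ℂ] H} (hS : IsSemibounded S)
    (f : (friedrichsExtension S).domain) (u : S.domain) :
    inner ℂ (friedrichsExtension S f) (u : H) = inner ℂ (f : H) (S u) := by
  rw [friedrichsExtension_apply f ⟨f, ((mem_domain_friedrichsExtension hS).1 f.2).2⟩ rfl]
  exact LinearPMap.adjoint_isFormalAdjoint hS.1 _ _

theorem le_friedrichsExtension {S : H →ₗ.[ℂ] H} (hS : IsSemibounded S) :
    S ≤ friedrichsExtension S := by
  have h := hS.2.1.le_adjoint hS.1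
  refine ⟨fun f hf => ?_, fun f g hfg => ?_⟩
  · exact (mem_domain_friedrichsExtension hS).2
      ⟨⟨fun _ => ⟨f, hf⟩, by simp, by simp⟩, h.1 hf⟩
  · rw [friedrichsExtension_apply g ⟨f, h.1 f.2⟩ hfg.symm]
    exact h.2 rfl

omit [CompleteSpace H] in
/-- A weak form of the Cauchy–Schwarz inequality, `|B (x, y)| ≤ B (x, x) + B (y, y)`, for the
nonnegative form `B (x, y) = ⟪x, (S - γ) y⟫`. -/
theorem IsSemibounded.norm_inner_le {S : H →ₗ.[ℂ] H} (hS : S.IsFormalAdjoint S) {γ : ℝ}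
    (hγ : ∀ f : S.domain, γ * ‖(f : H)‖ ^ 2 ≤ (inner ℂ (f : H) (S f)).re) (x y : S.domain) :
    ‖inner ℂ (x : H) (S y) - γ * inner ℂ (x : H) (y : H)‖ ≤
      ((inner ℂ (x : H) (S x)).re - γ * ‖(x : H)‖ ^ 2) +
        ((inner ℂ (y : H) (S y)).re - γ * ‖(y : H)‖ ^ 2) := by
  have key : ∀ z : S.domain,
      2 * |(inner ℂ (x : H) (S z) - γ * inner ℂ (x : H) (z : H)).re| ≤
      ((inner ℂ (x : H) (S x)).re - γ * ‖(x : H)‖ ^ 2) +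
        ((inner ℂ (z : H) (S z)).re - γ * ‖(z : H)‖ ^ 2) := by
    intro z
    have hsym : (inner ℂ (z : H) (S x)).re = (inner ℂ (x : H) (S z)).re := by
      rw [← hS z x, ← inner_conj_symm, Complex.conj_re]
    have hsym' : (inner ℂ (z : H) (x : H)).re = (inner ℂ (x : H) (z : H)).re := by
      rw [← inner_conj_symm, Complex.conj_re]
    have e : ∀ w : H, ‖w‖ ^ 2 = (inner ℂ w w).re := fun w => (inner_self_eq_norm_sq (𝕜 := ℂ) w).symm
    have h1 := hγ (x + z)
    have h2 := hγ (x - z)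
    rw [e] at h1 h2
    rw [e, e]
    simp only [Submodule.coe_add, Submodule.coe_sub, LinearPMap.map_add, LinearPMap.map_sub,
      inner_add_left, inner_add_right, inner_sub_left, inner_sub_right, Complex.add_re,
      Complex.sub_re, hsym, hsym'] at h1 h2
    have h3 : (inner ℂ (x : H) (S z) - γ * inner ℂ (x : H) (z : H)).re =
        (inner ℂ (x : H) (S z)).re - γ * (inner ℂ (x : H) (z : H)).re := by simp
    rw [h3]
    rcases abs_cases ((inner ℂ (x : H) (S z)).re - γ * (inner ℂ (x : H) (z : H)).re) with h | h <;>
      linarith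
  -- the imaginary part is the real part for `i y`
  have hI := key (Complex.I • y)
  have h1 := key y
  have h2 : |(inner ℂ (x : H) (S (Complex.I • y)) -
      γ * inner ℂ (x : H) ((Complex.I • y : S.domain) : H)).re| =
      |(inner ℂ (x : H) (S y) - γ * inner ℂ (x : H) (y : H)).im| := by
    rw [LinearPMap.map_smul, Submodule.coe_smul, inner_smul_right, inner_smul_right,
      ← abs_neg (Complex.im _)]
    congr 1
    simp
    ring
  have h3 : (inner ℂ ((Complex.I • y : S.domain) : H) (S (Complex.I • y))).re =
      (inner ℂ (y : H) (S y)).re := by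
    rw [LinearPMap.map_smul, Submodule.coe_smul, inner_smul_right, inner_smul_left]
    simp [← mul_assoc]
  have h4 : ‖((Complex.I • y : S.domain) : H)‖ = ‖(y : H)‖ := by
    simp [norm_smul]
  rw [h2, h3, h4] at hI
  have := Complex.norm_le_abs_re_add_abs_im
    (inner ℂ (x : H) (S y) - γ * inner ℂ (x : H) (y : H))
  linarith

/-- Every `f` in the domain of the Friedrichs extension is a limit of elements of the domain of the
original operator in the sense of the quadratic form. -/
theorem exists_tendsto_form {S : H →ₗ.[ℂ] H} (hS : IsSemibounded S)
    (f : (friedrichsExtension S).domain) :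
    ∃ u : ℕ → S.domain, ∃ v : ℕ → (friedrichsExtension S).domain,
      (∀ n, (v n : H) = u n) ∧ Tendsto (fun n => (u n : H)) atTop (𝓝 f) ∧
      Tendsto (fun n => inner ℂ ((f - v n : (friedrichsExtension S).domain) : H)
        (friedrichsExtension S (f - v n))) atTop (𝓝 0) := by
  have hle := le_friedrichsExtension hS
  obtain ⟨u, hu, hu'⟩ := ((mem_domain_friedrichsExtension hS).1 f.2).1
  refine ⟨u, fun n => ⟨u n, hle.1 (u n).2⟩, fun n => rfl, hu, ?_⟩
  have hsym := hS.2.1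
  obtain ⟨γ, hγ⟩ := hS.2.2
  -- the form of the differences, shifted so as to be nonnegative, is small
  have hC : Tendsto (fun p : ℕ × ℕ => (inner ℂ ((u p.1 - u p.2 : S.domain) : H)
      (S (u p.1 - u p.2))).re - γ * ‖((u p.1 - u p.2 : S.domain) : H)‖ ^ 2) atTop (𝓝 0) := by
    have h : Tendsto (fun p : ℕ × ℕ => ‖((u p.1 - u p.2 : S.domain) : H)‖ ^ 2) atTop (𝓝 0) := by
      rw [← prod_atTop_atTop_eq]
      have h := ((hu.comp tendsto_fst).sub (hu.comp tendsto_snd) :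
        Tendsto _ ((atTop : Filter ℕ) ×ˢ (atTop : Filter ℕ)) _)
      simpa using (h.norm.pow 2)
    simpa using hu'.sub (h.const_mul γ)
  have hlim : Tendsto (fun k =>
      inner ℂ ((f : H) - u k) (friedrichsExtension S (f - ⟨u k, hle.1 (u k).2⟩)) -
      γ * inner ℂ ((f : H) - u k) ((f : H) - u k)) atTop (𝓝 0) := by
    rw [Metric.tendsto_atTop]
    intro ε hε
    obtain ⟨⟨N₁, N₂⟩, hN⟩ := (Metric.tendsto_atTop.1 hC) (ε / 4) (by positivity)
    refine ⟨max N₁ N₂, fun k hk => ?_⟩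
    have hsm : ∀ m ≥ max N₁ N₂, (inner ℂ ((u m - u k : S.domain) : H)
      (S (u m - u k))).re - γ * ‖((u m - u k : S.domain) : H)‖ ^ 2 ≤ ε / 4 := by
      intro m hm
      have := hN (m, k) ⟨(le_max_left _ _).trans hm, (le_max_right _ _).trans hk⟩
      rw [Real.dist_eq, sub_zero] at this
      exact (le_abs_self _).trans this.le
    -- pass to the limit in the first and then in the second argument of the form
    have hB : ∀ m ≥ max N₁ N₂, ∀ l ≥ max N₁ N₂,
        ‖inner ℂ ((u l : H) - u k) (S (u m - u k)) -
          γ * inner ℂ ((u l : H) - u k) ((u m : H) - u k)‖ ≤ ε / 2 := by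
      intro m hm l hl
      have := IsSemibounded.norm_inner_le hsym hγ (u l - u k) (u m - u k)
      have h1 := hsm m hm
      have h2 := hsm l hl
      simp only [Submodule.coe_sub] at this h1 h2 ⊢
      linarith
    have hB' : ∀ m ≥ max N₁ N₂,
        ‖inner ℂ ((f : H) - u k) (S (u m - u k)) -
          γ * inner ℂ ((f : H) - u k) ((u m : H) - u k)‖ ≤ ε / 2 := by
      intro m hm
      have hcl : IsClosed {g : H | ‖inner ℂ (g - u k) (S (u m - u k)) -
          γ * inner ℂ (g - u k) ((u m : H) - u k)‖ ≤ ε / 2} :=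
        isClosed_le (by fun_prop) continuous_const
      exact hcl.mem_of_tendsto hu (eventually_atTop.2 ⟨_, fun l hl => hB m hm l hl⟩)
    have hB'' : ‖inner ℂ (friedrichsExtension S (f - ⟨u k, hle.1 (u k).2⟩)) ((f : H) - u k) -
          γ * inner ℂ ((f : H) - u k) ((f : H) - u k)‖ ≤ ε / 2 := by
      have hcl : IsClosed {g : H |
          ‖inner ℂ (friedrichsExtension S (f - ⟨u k, hle.1 (u k).2⟩)) (g - u k) -
          γ * inner ℂ ((f : H) - u k) (g - u k)‖ ≤ ε / 2} :=
        isClosed_le (by fun_prop) continuous_const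
      refine hcl.mem_of_tendsto hu (eventually_atTop.2 ⟨max N₁ N₂, fun m hm => ?_⟩)
      have h := inner_friedrichsExtension hS (f - ⟨u k, hle.1 (u k).2⟩) (u m - u k)
      simp only [Submodule.coe_sub] at h
      rw [mem_ofPred_eq, h]
      exact hB' m hm
    rw [dist_zero_right]
    refine lt_of_le_of_lt ?_ (half_lt_self hε)
    rw [← RCLike.norm_conj, map_sub, inner_conj_symm, map_mul, inner_conj_symm, Complex.conj_ofReal]
    exact hB''
  have h0 : Tendsto (fun k => (γ : ℂ) * inner ℂ ((f : H) - u k) ((f : H) - u k)) atTop (𝓝 0) := by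
    have : Tendsto (fun k => (f : H) - u k) atTop (𝓝 0) := by
      simpa using hu.const_sub (f : H)
    simpa using (this.inner this).const_mul (γ : ℂ)
  simpa using hlim.add h0

/-- The quadratic form of the Friedrichs extension is real, with the lower bound of the original
operator. -/
theorem friedrichsExtension_form {S : H →ₗ.[ℂ] H} (hS : IsSemibounded S) {γ : ℝ}
    (hγ : ∀ f : S.domain, γ * ‖(f : H)‖ ^ 2 ≤ (inner ℂ (f : H) (S f)).re)
    (f : (friedrichsExtension S).domain) :
    (inner ℂ (f : H) (friedrichsExtension S f)).im = 0 ∧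
      γ * ‖(f : H)‖ ^ 2 ≤ (inner ℂ (f : H) (friedrichsExtension S f)).re := by
  obtain ⟨u, v, huv, hu, hq⟩ := exists_tendsto_form hS f
  have hle := le_friedrichsExtension hS
  have hTv : ∀ n, friedrichsExtension S (v n) = S (u n) := fun n => (hle.2 (huv n).symm).symm
  have hsymm : ∀ n, ∀ g : (friedrichsExtension S).domain,
      inner ℂ (g : H) (S (u n)) = inner ℂ (friedrichsExtension S g) (u n : H) :=
    fun n g => (inner_friedrichsExtension hS g (u n)).symm
  have expand : ∀ n, inner ℂ (f : H) (friedrichsExtension S f) =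
      inner ℂ ((f - v n : (friedrichsExtension S).domain) : H)
        (friedrichsExtension S (f - v n)) +
      (inner ℂ (u n : H) (friedrichsExtension S (f - v n)) +
        inner ℂ (friedrichsExtension S (f - v n)) (u n : H)) +
        inner ℂ (u n : H) (S (u n)) := by
    intro n
    rw [← hsymm, LinearPMap.map_sub, hTv, Submodule.coe_sub, huv]
    simp only [inner_sub_left, inner_sub_right]
    ring
  have hreal : ∀ z w : H, inner ℂ z w + inner ℂ w z = ((2 * (inner ℂ z w).re : ℝ) : ℂ) := by
    intro z w
    rw [← inner_conj_symm w z, Complex.add_conj]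
  have huu : ∀ n, (inner ℂ (u n : H) (S (u n))).im = 0 := by
    intro n
    rw [← Complex.conj_eq_iff_im, inner_conj_symm]
    exact hS.2.1 _ _
  constructor
  · have h1 : ∀ n, (inner ℂ (f : H) (friedrichsExtension S f)).im =
        (inner ℂ ((f - v n : (friedrichsExtension S).domain) : H)
          (friedrichsExtension S (f - v n))).im := by
      intro n
      conv_lhs => rw [expand n, hreal]
      simp [huu]
    have h2 := (Complex.continuous_im.tendsto _).comp hq
    refine tendsto_nhds_unique ?_ h2
    simpa only [Function.comp_def, ← h1] using tendsto_const_nhds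
  · -- `⟪u n, T (f - v n)⟫` tends to zero
    have h0 : Tendsto (fun n => (f : H) - u n) atTop (𝓝 0) := by
      simpa using hu.const_sub (f : H)
    have h1 : Tendsto (fun n => inner ℂ (friedrichsExtension S (f - v n)) (u n : H))
        atTop (𝓝 0) := by
      have h2 : ∀ n, inner ℂ (friedrichsExtension S (f - v n)) (u n : H) =
          inner ℂ ((f : H) - u n) (friedrichsExtension S f) -
            inner ℂ ((f - v n : (friedrichsExtension S).domain) : H)
              (friedrichsExtension S (f - v n)) := by
        intro n
        rw [← hsymm, LinearPMap.map_sub, hTv, Submodule.coe_sub, huv, inner_sub_right]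
        ring
      simp only [h2]
      have h3 := (h0.inner (𝕜 := ℂ) (tendsto_const_nhds (x := friedrichsExtension S f))).sub hq
      simpa only [inner_zero_left, sub_zero] using h3
    have h2 : Tendsto (fun n => inner ℂ (u n : H) (friedrichsExtension S (f - v n)))
        atTop (𝓝 0) := by
      have h3 := (Complex.continuous_conj.tendsto _).comp h1
      simpa only [Function.comp_def, inner_conj_symm, map_zero] using h3
    have h3 : Tendsto (fun n => γ * ‖(u n : H)‖ ^ 2 +
        (inner ℂ ((f - v n : (friedrichsExtension S).domain) : H)
          (friedrichsExtension S (f - v n)) +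
      (inner ℂ (u n : H) (friedrichsExtension S (f - v n)) +
        inner ℂ (friedrichsExtension S (f - v n)) (u n : H))).re) atTop
        (𝓝 (γ * ‖(f : H)‖ ^ 2)) := by
      have := (Complex.continuous_re.tendsto _).comp (hq.add (h2.add h1))
      simpa using ((hu.norm.pow 2).const_mul γ).add this
    refine le_of_tendsto h3 (Eventually.of_forall fun n => ?_)
    conv_rhs => rw [expand n, Complex.add_re]
    linarith [hγ (u n)]

theorem friedrichsExtension_isFormalAdjoint {S : H →ₗ.[ℂ] H} (hS : IsSemibounded S) :
    (friedrichsExtension S).IsFormalAdjoint (friedrichsExtension S) := by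
  obtain ⟨γ, hγ⟩ := hS.2.2
  have him := fun f => (friedrichsExtension_form hS hγ f).1
  intro f g
  have h1 := him (f + g)
  have h2 := him (f + Complex.I • g)
  -- the real and imaginary parts of the polarization identity come from `f + g` and `f + i g`
  have hII : (inner ℂ ((Complex.I • g : (friedrichsExtension S).domain) : H)
      (friedrichsExtension S (Complex.I • g))).im = 0 := him _
  rw [LinearPMap.map_add, Submodule.coe_add, inner_add_left, inner_add_right, inner_add_right]
    at h1 h2
  simp only [Complex.add_im, hII, him f, him g] at h1 h2
  simp only [LinearPMap.map_smul, Submodule.coe_smul, inner_smul_left, inner_smul_right,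
    Complex.mul_im, Complex.I_re, Complex.I_im, Complex.conj_I, Complex.neg_re, Complex.neg_im]
    at h2
  rw [← inner_conj_symm]
  apply Complex.ext
  · rw [Complex.conj_re]
    linarith
  · rw [Complex.conj_im]
    linarith

/-- If `F n` converges in the graph norm, elements of the domain of `S` that are close to `F n` in
the form norm show that the limit lies in the form domain. -/
theorem friedrichsExtension_isClosed {S : H →ₗ.[ℂ] H} (hS : IsSemibounded S)
    {F : ℕ → (friedrichsExtension S).domain} {f g : H}
    (hF : Tendsto (fun n => (F n : H)) atTop (𝓝 f))
    (hTF : Tendsto (fun n => friedrichsExtension S (F n)) atTop (𝓝 g)) :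
    ∃ h : f ∈ (friedrichsExtension S).domain, friedrichsExtension S ⟨f, h⟩ = g := by
  obtain ⟨γ, hγ⟩ := hS.2.2
  have hpos := fun f => (friedrichsExtension_form hS hγ f).2
  have hle := le_friedrichsExtension hS
  -- `f` lies in the domain of the adjoint
  have hadj : ∀ x : S.domain, inner ℂ g (x : H) = inner ℂ f (S x) := by
    intro x
    have h1 : Tendsto (fun n => inner ℂ (friedrichsExtension S (F n)) (x : H)) atTop
        (𝓝 (inner ℂ g (x : H))) :=
      hTF.inner tendsto_const_nhds
    have h2 : Tendsto (fun n => inner ℂ (F n : H) (S x)) atTop (𝓝 (inner ℂ f (S x))) :=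
      hF.inner tendsto_const_nhds
    simp only [inner_friedrichsExtension hS] at h1
    exact tendsto_nhds_unique h1 h2
  have hfadj : f ∈ S.adjoint.domain := LinearPMap.mem_adjoint_domain_of_exists _ ⟨g, hadj⟩
  -- the nonnegative form `a` on the domain of the extension
  set a : (friedrichsExtension S).domain → ℝ := fun h =>
    (inner ℂ (h : H) (friedrichsExtension S h)).re - γ * ‖(h : H)‖ ^ 2 with ha
  have ha0 : ∀ h, 0 ≤ a h := fun h => sub_nonneg.2 (hpos h)
  have hadd : ∀ x y : (friedrichsExtension S).domain, a (x + y) ≤ 2 * (a x + a y) := by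
    intro x y
    have h1 := ha0 (x - y)
    have e : ∀ w : H, ‖w‖ ^ 2 = (inner ℂ w w).re := fun w => (inner_self_eq_norm_sq (𝕜 := ℂ) w).symm
    simp only [ha, e, Submodule.coe_add, Submodule.coe_sub, LinearPMap.map_add, LinearPMap.map_sub,
      inner_add_left, inner_add_right, inner_sub_left, inner_sub_right, Complex.add_re,
      Complex.sub_re] at h1 ⊢
    linarith
  have hneg : ∀ x : (friedrichsExtension S).domain, a (-x) = a x := by
    intro x
    simp [ha, LinearPMap.map_neg]
  -- approximate `F n` up to `1 / (n + 1)` in the form norm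
  have hex : ∀ n : ℕ, ∃ u : S.domain, ∃ v : (friedrichsExtension S).domain, (v : H) = u ∧
      ‖(F n : H) - u‖ < 1 / ((n : ℝ) + 1) ∧ a (F n - v) < 1 / ((n : ℝ) + 1) := by
    intro n
    obtain ⟨u, v, huv, hu, hq⟩ := exists_tendsto_form hS (F n)
    have hε : (0 : ℝ) < 1 / ((n : ℝ) + 1) := Nat.one_div_pos_of_nat
    have h0 : Tendsto (fun k => ‖(F n : H) - u k‖) atTop (𝓝 0) := by
      simpa using (hu.const_sub (F n : H)).norm
    have h1 : Tendsto (fun k => a (F n - v k)) atTop (𝓝 0) := by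
      have h2 := (Complex.continuous_re.tendsto _).comp hq
      have h3 := h2.sub ((h0.pow 2).const_mul γ)
      simpa [ha, huv, Function.comp_def] using h3
    obtain ⟨k, hk1, hk2⟩ := ((h0.eventually_lt_const hε).and (h1.eventually_lt_const hε)).exists
    exact ⟨u k, v k, huv k, hk1, hk2⟩
  choose u v huv hu hv using hex
  have hform : f ∈ formDomain S := by
    have h1 := tendsto_one_div_add_atTop_nhds_zero_nat (𝕜 := ℝ)
    have hd : Tendsto (fun n => (F n : H) - u n) atTop (𝓝 0) :=
      squeeze_zero_norm (fun n => (hu n).le) h1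
    have hu' : Tendsto (fun n => (u n : H)) atTop (𝓝 f) := by
      simpa using hF.sub hd
    refine ⟨u, hu', ?_⟩
    have hN : ∀ {w : ℕ → H} {z : H}, Tendsto w atTop (𝓝 z) →
        Tendsto (fun p : ℕ × ℕ => w p.1 - w p.2) atTop (𝓝 0) := by
      intro w z hw
      rw [← prod_atTop_atTop_eq]
      simpa using ((hw.comp tendsto_fst).sub (hw.comp tendsto_snd) :
        Tendsto _ ((atTop : Filter ℕ) ×ˢ (atTop : Filter ℕ)) _)
    have h2 : Tendsto (fun p : ℕ × ℕ => a (F p.1 - F p.2)) atTop (𝓝 0) := by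
      have h3 := (Complex.continuous_re.tendsto _).comp ((hN hF).inner (𝕜 := ℂ) (hN hTF))
      have h4 := h3.sub (((hN hF).norm.pow 2).const_mul γ)
      have h5 : (inner ℂ (0 : H) (0 : H)).re - γ * ‖(0 : H)‖ ^ 2 = 0 := by simp
      rw [h5] at h4
      refine h4.congr fun p => ?_
      simp only [ha, LinearPMap.map_sub, Submodule.coe_sub, Function.comp_apply]
    have h1' : Tendsto (fun p : ℕ × ℕ => 1 / ((p.1 : ℝ) + 1) + 1 / ((p.2 : ℝ) + 1))
        atTop (𝓝 0) := by
      rw [← prod_atTop_atTop_eq]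
      simpa using ((h1.comp tendsto_fst).add (h1.comp tendsto_snd) :
        Tendsto _ ((atTop : Filter ℕ) ×ˢ (atTop : Filter ℕ)) _)
    have hub : ∀ p : ℕ × ℕ, a (v p.1 - v p.2) ≤ 2 * (a (F p.1 - F p.2) +
        2 * (1 / ((p.1 : ℝ) + 1) + 1 / ((p.2 : ℝ) + 1))) := by
      intro p
      have e : v p.1 - v p.2 = (F p.1 - F p.2) + (-(F p.1 - v p.1) + (F p.2 - v p.2)) := by abel
      rw [e]
      have h3 := hadd (F p.1 - F p.2) (-(F p.1 - v p.1) + (F p.2 - v p.2))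
      have h4 := hadd (-(F p.1 - v p.1)) (F p.2 - v p.2)
      rw [hneg] at h4
      linarith [hv p.1, hv p.2]
    have h5 : Tendsto (fun p : ℕ × ℕ => a (v p.1 - v p.2)) atTop (𝓝 0) :=
      squeeze_zero (fun p => ha0 _) hub (by simpa using (h2.add (h1'.const_mul 2)).const_mul 2)
    have h6 := h5.add (((hN hu').norm.pow 2).const_mul γ)
    have h7 : ∀ p : ℕ × ℕ, friedrichsExtension S (v p.1 - v p.2) = S (u p.1 - u p.2) := fun p =>
      (hle.2 (by simp [huv])).symm
    simpa [ha, h7, huv] using h6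
  refine ⟨(mem_domain_friedrichsExtension hS).2 ⟨hform, hfadj⟩, ?_⟩
  rw [friedrichsExtension_apply _ ⟨f, hfadj⟩ rfl]
  exact LinearPMap.adjoint_apply_eq hS.1 _ hadj

end Abstract

/-! ### Symmetric operators with a complete set of eigenvectors -/

section Diagonal

variable {H : Type*} [NormedAddCommGroup H] [InnerProductSpace ℂ H]

/-- Parseval's identity. -/
theorem hasSum_norm_inner_sq (b : HilbertBasis ℕ ℂ H) (x : H) :
    HasSum (fun n => ‖inner ℂ (b n) x‖ ^ 2) (‖x‖ ^ 2) := by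
  have h := (b.hasSum_inner_mul_inner x x).mapL Complex.reCLM
  have h1 : Complex.reCLM (inner ℂ x x) = ‖x‖ ^ 2 := inner_self_eq_norm_sq (𝕜 := ℂ) x
  rw [h1] at h
  refine h.congr_fun fun n => ?_
  rw [← inner_conj_symm x (b n), Complex.reCLM_apply, ← Complex.normSq_eq_conj_mul_self,
    Complex.ofReal_re, Complex.normSq_eq_norm_sq]

/-- The vectors of the Hilbert basis `b` are eigenvectors of `T`, with eigenvalues `ev`. -/
def IsEigenbasis (T : H →ₗ.[ℂ] H) (b : HilbertBasis ℕ ℂ H) (ev : ℕ → ℝ) : Prop :=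
  ∀ n, ∃ h : b n ∈ T.domain, T ⟨b n, h⟩ = (ev n : ℂ) • b n

/-- The graph of `T` is sequentially closed. -/
def IsSeqClosedGraph (T : H →ₗ.[ℂ] H) : Prop :=
  ∀ (F : ℕ → T.domain) (f g : H), Tendsto (fun n => (F n : H)) atTop (𝓝 f) →
    Tendsto (fun n => T (F n)) atTop (𝓝 g) → ∃ h : f ∈ T.domain, T ⟨f, h⟩ = g

variable {T : H →ₗ.[ℂ] H} {b : HilbertBasis ℕ ℂ H} {ev : ℕ → ℝ}

theorem IsEigenbasis.inner_apply (hb : IsEigenbasis T b ev) (hT : T.IsFormalAdjoint T) (n : ℕ)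
    (f : T.domain) : inner ℂ (b n) (T f) = ev n * inner ℂ (b n) (f : H) := by
  obtain ⟨h, he⟩ := hb n
  have := hT ⟨b n, h⟩ f
  rw [he, inner_smul_left, Complex.conj_ofReal] at this
  exact this.symm

/-- By Parseval, `T - z` is bounded below by the distance of `z` to the eigenvalues. -/
theorem IsEigenbasis.norm_le (hb : IsEigenbasis T b ev) (hT : T.IsFormalAdjoint T) {z : ℂ} {δ : ℝ}
    (hδ : 0 < δ) (hz : ∀ n, δ ≤ ‖(ev n : ℂ) - z‖) (f : T.domain) :
    δ * ‖(f : H)‖ ≤ ‖T f - z • (f : H)‖ := by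
  have h1 := (hasSum_norm_inner_sq b (f : H)).mul_left (δ ^ 2)
  have h2 := hasSum_norm_inner_sq b (T f - z • (f : H))
  have h3 : δ ^ 2 * ‖(f : H)‖ ^ 2 ≤ ‖T f - z • (f : H)‖ ^ 2 := by
    refine hasSum_le (fun n => ?_) h1 h2
    rw [inner_sub_right, inner_smul_right, hb.inner_apply hT, ← sub_mul, norm_mul, mul_pow]
    gcongr
    exact hz n
  rw [← mul_pow] at h3
  exact (sq_le_sq₀ (by positivity) (norm_nonneg _)).1 h3

/-- The range of `T - z` contains the eigenvectors, hence is dense, and it is closed because `T` is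
closed and `T - z` is bounded below. -/
theorem IsEigenbasis.surjective [CompleteSpace H] (hb : IsEigenbasis T b ev)
    (hT : T.IsFormalAdjoint T) (hcl : IsSeqClosedGraph T) {z : ℂ} {δ : ℝ}
    (hδ : 0 < δ) (hz : ∀ n, δ ≤ ‖(ev n : ℂ) - z‖) (g : H) :
    ∃ f : T.domain, T f - z • (f : H) = g := by
  let A : T.domain →ₗ[ℂ] H := T.toFun - z • T.domain.subtype
  have hA : ∀ f, A f = T f - z • (f : H) := fun f => rfl
  have hspan : Submodule.span ℂ (range b) ≤ LinearMap.range A := by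
    refine Submodule.span_le.2 ?_
    rintro _ ⟨n, rfl⟩
    obtain ⟨h, he⟩ := hb n
    have hne : (ev n : ℂ) - z ≠ 0 := norm_pos_iff.1 (hδ.trans_le (hz n))
    refine ⟨((ev n : ℂ) - z)⁻¹ • ⟨b n, h⟩, ?_⟩
    rw [map_smul, hA, he, ← sub_smul, smul_smul, inv_mul_cancel₀ hne, one_smul]
  have hg : g ∈ _root_.closure (LinearMap.range A : Set H) := by
    refine closure_mono hspan ?_
    have := b.dense_span
    rw [← Submodule.topologicalClosure_coe, this]
    trivial
  obtain ⟨G, hG, hGg⟩ := mem_closure_iff_seq_limit.1 hg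
  choose F hF using hG
  have hCauchy : CauchySeq fun n => (F n : H) := by
    rw [Metric.cauchySeq_iff]
    intro ε hε
    obtain ⟨N, hN⟩ := Metric.cauchySeq_iff.1 hGg.cauchySeq (δ * ε) (by positivity)
    refine ⟨N, fun m hm n hn => ?_⟩
    have h1 := hN m hm n hn
    have h2 := hb.norm_le hT hδ hz (F m - F n)
    rw [← hA, map_sub, hF, hF, ← dist_eq_norm] at h2
    rw [dist_eq_norm]
    exact lt_of_mul_lt_mul_left (h2.trans_lt h1) hδ.le
  obtain ⟨f, hf⟩ := cauchySeq_tendsto_of_complete hCauchy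
  have hTF : Tendsto (fun n => T (F n)) atTop (𝓝 (g + z • f)) := by
    refine (hGg.add (hf.const_smul z)).congr fun n => ?_
    rw [← hF, hA, sub_add_cancel]
  obtain ⟨h, he⟩ := hcl F f _ hf hTF
  exact ⟨⟨f, h⟩, by rw [he, add_sub_cancel_right]⟩

theorem IsEigenbasis.mem_resolventSet [CompleteSpace H] (hb : IsEigenbasis T b ev)
    (hT : T.IsFormalAdjoint T) (hcl : IsSeqClosedGraph T) {z : ℂ} {δ : ℝ}
    (hδ : 0 < δ) (hz : ∀ n, δ ≤ ‖(ev n : ℂ) - z‖) : z ∈ resolventSet T := by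
  let A : T.domain →ₗ[ℂ] H := T.toFun - z • T.domain.subtype
  have hA : ∀ f, A f = T f - z • (f : H) := fun f => rfl
  have hinj : Function.Injective A := by
    refine (injective_iff_map_eq_zero A).2 fun f hf => ?_
    have h := hb.norm_le hT hδ hz f
    rw [← hA, hf, norm_zero] at h
    have : ‖(f : H)‖ = 0 := le_antisymm (by nlinarith [norm_nonneg (f : H)]) (norm_nonneg _)
    exact Subtype.ext (norm_eq_zero.1 this)
  let e := LinearEquiv.ofBijective A ⟨hinj, hb.surjective hT hcl hδ hz⟩
  have he : ∀ g, A (e.symm g) = g := fun g => e.apply_symm_apply g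
  let R : H →L[ℂ] H := (T.domain.subtype ∘ₗ e.symm.toLinearMap).mkContinuous δ⁻¹ fun g => by
    have h := hb.norm_le hT hδ hz (e.symm g)
    rw [← hA, he] at h
    rw [inv_mul_eq_div, le_div_iff₀' hδ]
    exact h
  refine ⟨R, fun g => ⟨e.symm g, rfl, he g⟩, fun f => ?_⟩
  have : e.symm (T f - z • (f : H)) = f := e.symm_apply_apply f
  exact congrArg Subtype.val this

/-- A closed symmetric operator with a complete set of eigenvectors is self-adjoint. -/
theorem IsEigenbasis.isSelfAdjoint [CompleteSpace H] (hb : IsEigenbasis T b ev)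
    (hT : T.IsFormalAdjoint T) (hcl : IsSeqClosedGraph T) : IsSelfAdjoint T := by
  have hdense : Dense (T.domain : Set H) := by
    refine Dense.mono (Submodule.span_le.2 ?_ : Submodule.span ℂ (range b) ≤ T.domain)
      (Submodule.dense_iff_topologicalClosure_eq_top.2 b.dense_span)
    rintro _ ⟨n, rfl⟩
    exact (hb n).1
  have hI : ∀ n, (1 : ℝ) ≤ ‖(ev n : ℂ) - Complex.I‖ := fun n => by
    simpa using Complex.abs_im_le_norm ((ev n : ℂ) - Complex.I)
  have hI' : ∀ n, (1 : ℝ) ≤ ‖(ev n : ℂ) - -Complex.I‖ := fun n => by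
    simpa using Complex.abs_im_le_norm ((ev n : ℂ) - -Complex.I)
  rw [LinearPMap.isSelfAdjoint_def]
  refine (LinearPMap.eq_of_le_of_domain_eq (hT.le_adjoint hdense) ?_).symm
  refine le_antisymm (hT.le_adjoint hdense).1 fun f hf => ?_
  -- `T - i` is onto, and `T + i` has dense range
  obtain ⟨h, hh⟩ := hb.surjective hT hcl one_pos hI (T.adjoint ⟨f, hf⟩ - Complex.I • f)
  obtain ⟨u, hu⟩ := hb.surjective hT hcl one_pos hI' (f - h)
  have h1 : inner ℂ (f - h) (f - h) = (0 : ℂ) := by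
    have h2 := LinearPMap.adjoint_isFormalAdjoint hdense ⟨f, hf⟩ u
    have h3 := hT h u
    have h4 : inner ℂ (T h - Complex.I • (h : H)) (u : H) =
      inner ℂ (T.adjoint ⟨f, hf⟩ - Complex.I • f) (u : H) := by rw [hh]
    rw [inner_sub_left, inner_sub_left, inner_smul_left, inner_smul_left, Complex.conj_I, h2, h3]
      at h4
    nth_rewrite 2 [← hu]
    rw [inner_sub_left, inner_sub_right, inner_sub_right, inner_smul_right, inner_smul_right]
    linear_combination -h4
  have h2 : f = h := sub_eq_zero.1 (inner_self_eq_zero.1 h1)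
  rw [h2]
  exact h.2

theorem IsEigenbasis.notMem_resolventSet (hb : IsEigenbasis T b ev) (n : ℕ) :
    (ev n : ℂ) ∉ resolventSet T := by
  rintro ⟨R, -, hR⟩
  obtain ⟨h, he⟩ := hb n
  have h1 := hR ⟨b n, h⟩
  rw [he, sub_self, map_zero] at h1
  have h2 := b.orthonormal.1 n
  rw [← show (0 : H) = b n from h1, norm_zero] at h2
  exact zero_ne_one h2

/-- Every set of eigenvalues is closed, since the eigenvalues tend to infinity. -/
theorem isClosed_image_of_tendsto (hev : Tendsto ev atTop atTop) (s : Set ℕ) :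
    IsClosed ((fun n => (ev n : ℂ)) '' s) := by
  have h : IsProperMap fun n => (ev n : ℂ) := by
    rw [isProperMap_iff_tendsto_cocompact]
    refine ⟨continuous_of_discreteTopology, ?_⟩
    rw [cocompact_eq_cofinite, Nat.cofinite_eq_atTop]
    exact Complex.isometry_ofReal.isClosedEmbedding.tendsto_cocompact.comp
      (hev.mono_right atTop_le_cocompact)
  exact h.isClosedMap _ (isClosed_discrete s)

theorem IsEigenbasis.spectrum_eq [CompleteSpace H] (hb : IsEigenbasis T b ev)
    (hT : T.IsFormalAdjoint T) (hcl : IsSeqClosedGraph T) (hev : Tendsto ev atTop atTop) :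
    spectrum T = range fun n => (ev n : ℂ) := by
  refine Subset.antisymm (fun z hz => ?_) ?_
  · by_contra hzr
    have hcl' := isClosed_image_of_tendsto hev univ
    rw [image_univ] at hcl'
    obtain ⟨δ, hδ, hball⟩ := Metric.isOpen_iff.1 hcl'.isOpen_compl z hzr
    refine hz (hb.mem_resolventSet hT hcl hδ fun n => ?_)
    by_contra! hlt
    exact hball (by rwa [Metric.mem_ball, dist_eq_norm]) ⟨n, rfl⟩
  · rintro _ ⟨n, rfl⟩
    exact hb.notMem_resolventSet n

theorem IsEigenbasis.eigenspace_eq (hb : IsEigenbasis T b ev)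
    (hT : T.IsFormalAdjoint T) (hinj : Function.Injective ev) (n : ℕ) :
    eigenspace T (ev n : ℂ) = Submodule.span ℂ {b n} := by
  refine le_antisymm (fun f hf => ?_) ?_
  · obtain ⟨h, he⟩ := mem_eigenspace_iff.1 hf
    have h0 : ∀ m, m ≠ n → inner ℂ (b m) f = (0 : ℂ) := by
      intro m hm
      have h1 := hb.inner_apply hT m ⟨f, h⟩
      rw [he, inner_smul_right] at h1
      have h2 : ((ev n : ℂ) - ev m) * inner ℂ (b m) f = 0 := by rw [sub_mul, h1, sub_self]
      refine (mul_eq_zero.1 h2).resolve_left fun h3 => hm (hinj ?_)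
      exact_mod_cast (sub_eq_zero.1 h3).symm
    have h1 := b.hasSum_repr f
    have h2 : HasSum (fun i => b.repr f i • b i) (b.repr f n • b n) :=
      hasSum_single n fun m hm => by rw [b.repr_apply_apply, h0 m hm, zero_smul]
    rw [h1.unique h2]
    exact Submodule.smul_mem _ _ (Submodule.mem_span_singleton_self _)
  · rw [Submodule.span_le, singleton_subset_iff]
    exact mem_eigenspace_iff.2 (hb n)

theorem IsEigenbasis.finrank_eigenspace (hb : IsEigenbasis T b ev)
    (hT : T.IsFormalAdjoint T) (hinj : Function.Injective ev) (n : ℕ) :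
    Module.finrank ℂ (eigenspace T (ev n : ℂ)) = 1 := by
  rw [hb.eigenspace_eq hT hinj]
  exact finrank_span_singleton (b.orthonormal.ne_zero n)

theorem IsEigenbasis.discreteSpectrum_eq [CompleteSpace H] (hb : IsEigenbasis T b ev)
    (hT : T.IsFormalAdjoint T) (hcl : IsSeqClosedGraph T) (hev : Tendsto ev atTop atTop)
    (hinj : Function.Injective ev) : discreteSpectrum T = spectrum T := by
  refine Subset.antisymm ?_ fun z hz => ?_
  · rintro z ⟨⟨U, -, hU⟩, -⟩
    exact (hU.ge rfl).1
  · have hspec := hb.spectrum_eq hT hcl hev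
    rw [hspec] at hz
    obtain ⟨n, rfl⟩ := hz
    refine ⟨⟨((fun n => (ev n : ℂ)) '' {n}ᶜ)ᶜ, ?_, ?_⟩, ?_, ?_⟩
    · refine (isClosed_image_of_tendsto hev _).isOpen_compl.mem_nhds ?_
      rintro ⟨m, hm, hmn⟩
      exact hm (hinj (Complex.ofReal_injective hmn))
    · rw [hspec]
      refine Subset.antisymm ?_ ?_
      · rintro _ ⟨⟨m, rfl⟩, hm⟩
        by_contra hne
        exact hm ⟨m, fun h => hne (by rw [mem_singleton_iff.1 h]; rfl), rfl⟩
      · rintro _ rfl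
        refine ⟨⟨n, rfl⟩, ?_⟩
        rintro ⟨m, hm, hmn⟩
        exact hm (hinj (Complex.ofReal_injective hmn))
    · intro h
      have := hb.finrank_eigenspace hT hinj n
      rw [h, finrank_bot] at this
      exact zero_ne_one this
    · exact Module.finite_of_finrank_eq_succ (hb.finrank_eigenspace hT hinj n)

end Diagonal

/-! ### Integration by parts against test functions -/

/-- Lebesgue measure on `(0,π)`. -/
noncomputable abbrev mu : Measure ℝ := volume.restrict (Ioo (0 : ℝ) Real.pi)

theorem continuous_of_continuousOn_Ioo {g : ℝ → ℂ} {K : Set ℝ} (hK : IsCompact K)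
    (hKs : K ⊆ Ioo 0 Real.pi) (hg : ContinuousOn g (Ioo 0 Real.pi)) (hgK : ∀ x ∉ K, g x = 0) :
    Continuous g := by
  rw [continuous_iff_continuousAt]
  intro x
  by_cases hx : x ∈ K
  · exact hg.continuousAt (isOpen_Ioo.mem_nhds (hKs hx))
  · have h : g =ᶠ[𝓝 x] fun _ => 0 := by
      filter_upwards [hK.isClosed.isOpen_compl.mem_nhds hx] with y hy using hgK y hy
    exact (continuousAt_congr h).2 continuousAt_const

theorem memLp_of_continuousOn_Ioo {g : ℝ → ℂ} {K : Set ℝ} (hK : IsCompact K)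
    (hKs : K ⊆ Ioo 0 Real.pi) (hg : ContinuousOn g (Ioo 0 Real.pi)) (hgK : ∀ x ∉ K, g x = 0) :
    MemLp g 2 mu :=
  ((continuous_of_continuousOn_Ioo hK hKs hg hgK).memLp_of_hasCompactSupport
    (HasCompactSupport.intro hK hgK)).restrict _

/-- The integral over `(0,π)` of a derivative of a function with compact support in `(0,π)`
vanishes. -/
theorem integral_deriv_eq_zero_of_compact {W W' : ℝ → ℂ} {K : Set ℝ} (hK : IsCompact K)
    (hKs : K ⊆ Ioo 0 Real.pi) (hd : ∀ x ∈ Ioo 0 Real.pi, HasDerivAt W (W' x) x)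
    (hc : ContinuousOn W' (Ioo 0 Real.pi)) (hW : ∀ x ∉ K, W x = 0) (hW' : ∀ x ∉ K, W' x = 0) :
    ∫ x, W' x ∂mu = 0 := by
  have hcW : ContinuousOn W (Ioo 0 Real.pi) := fun x hx => (hd x hx).continuousAt.continuousWithinAt
  have h1 := (continuous_of_continuousOn_Ioo hK hKs hc hW').integrable_of_hasCompactSupport
    (μ := volume) (HasCompactSupport.intro hK hW')
  have h2 := (continuous_of_continuousOn_Ioo hK hKs hcW hW).integrable_of_hasCompactSupport
    (μ := volume) (HasCompactSupport.intro hK hW)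
  rw [setIntegral_eq_integral_of_forall_compl_eq_zero fun x hx => hW' x fun h => hx (hKs h)]
  refine integral_eq_zero_of_hasDerivAt_of_integrable (f := W) (fun x => ?_) h1 h2
  by_cases hx : x ∈ K
  · exact hd x (hKs hx)
  · have h : W =ᶠ[𝓝 x] fun _ => 0 := by
      filter_upwards [hK.isClosed.isOpen_compl.mem_nhds hx] with y hy using hW y hy
    rw [hW' x hx]
    exact (hasDerivAt_const x (0 : ℂ)).congr_of_eventuallyEq h

namespace IsTestFunction

variable {φ ψ : ℝ → ℂ}

theorem eq_zero (_ : IsTestFunction φ) {x : ℝ} (hx : x ∉ tsupport φ) : φ x = 0 :=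
  image_eq_zero_of_notMem_tsupport hx

theorem deriv_eq_zero (_ : IsTestFunction φ) {x : ℝ} (hx : x ∉ tsupport φ) : deriv φ x = 0 :=
  image_eq_zero_of_notMem_tsupport fun h => hx (tsupport_deriv_subset (𝕜 := ℝ) h)

theorem deriv_deriv_eq_zero (_ : IsTestFunction φ) {x : ℝ} (hx : x ∉ tsupport φ) :
    deriv (deriv φ) x = 0 :=
  image_eq_zero_of_notMem_tsupport fun h =>
    hx (tsupport_deriv_subset (𝕜 := ℝ) (tsupport_deriv_subset (𝕜 := ℝ) h))

theorem continuous_deriv (h : IsTestFunction φ) : Continuous (deriv φ) :=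
  h.hasDerivs.2.continuous

theorem continuous_deriv_deriv (h : IsTestFunction φ) : Continuous (deriv (deriv φ)) := by
  have h1 : ContDiff ℝ ∞ (deriv φ) := ((contDiff_infty_iff_deriv).1 h.1).2
  exact ((contDiff_infty_iff_deriv).1 h1).2.continuous

theorem hasDerivAt (h : IsTestFunction φ) (x : ℝ) : HasDerivAt φ (deriv φ x) x :=
  (h.hasDerivs.1 x).hasDerivAt

theorem hasDerivAt_deriv (h : IsTestFunction φ) (x : ℝ) :
    HasDerivAt (deriv φ) (deriv (deriv φ) x) x :=
  (h.hasDerivs.2 x).hasDerivAt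

theorem sub (hφ : IsTestFunction φ) (hψ : IsTestFunction ψ) : IsTestFunction (φ - ψ) :=
  ⟨hφ.1.sub hψ.1, hφ.2.1.sub hψ.2.1, (tsupport_sub φ ψ).trans (union_subset hφ.2.2 hψ.2.2)⟩

theorem memLp (h : IsTestFunction φ) : MemLp φ 2 mu :=
  memLp_of_continuousOn_Ioo h.2.1 h.2.2 h.1.continuous.continuousOn fun _ => h.eq_zero

end IsTestFunction

theorem continuousOn_potential (s : ℝ) :
    ContinuousOn (fun x : ℝ => (((s ^ 2 - 1 / 4) / Real.sin x ^ 2 : ℝ) : ℂ)) (Ioo 0 Real.pi) := by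
  refine Complex.continuous_ofReal.comp_continuousOn ?_
  refine continuousOn_const.div (by fun_prop) fun x hx => ?_
  exact pow_ne_zero _ (Real.sin_pos_of_mem_Ioo hx).ne'

theorem IsTestFunction.continuousOn_tau {φ : ℝ → ℂ} (h : IsTestFunction φ) (s : ℝ) :
    ContinuousOn (tau s φ) (Ioo 0 Real.pi) :=
  h.continuous_deriv_deriv.continuousOn.neg.add
    ((continuousOn_potential s).mul h.1.continuous.continuousOn)

theorem IsTestFunction.memLp_tau {φ : ℝ → ℂ} (h : IsTestFunction φ) (s : ℝ) :
    MemLp (tau s φ) 2 mu :=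
  memLp_of_continuousOn_Ioo h.2.1 h.2.2 (h.continuousOn_tau s) fun x hx => by
    simp [tau, h.eq_zero hx, h.deriv_deriv_eq_zero hx]

/-- Green's formula: `τ_s` may be moved from a test function to a twice differentiable function. -/
theorem integral_mul_tau (s : ℝ) {φ v v' v'' : ℝ → ℂ} (hφ : IsTestFunction φ)
    (hv : ∀ x ∈ Ioo 0 Real.pi, HasDerivAt v (v' x) x)
    (hv' : ∀ x ∈ Ioo 0 Real.pi, HasDerivAt v' (v'' x) x)
    (hc : ContinuousOn v'' (Ioo 0 Real.pi)) :
    ∫ x, v x * tau s φ x ∂mu =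
      ∫ x, (-v'' x + (((s ^ 2 - 1 / 4) / Real.sin x ^ 2 : ℝ) : ℂ) * v x) * φ x ∂mu := by
  have hcv : ContinuousOn v (Ioo 0 Real.pi) := fun x hx => (hv x hx).continuousAt.continuousWithinAt
  have hφc := hφ.1.continuous.continuousOn (s := Ioo 0 Real.pi)
  have h1 : Integrable (fun x => v x * tau s φ x) mu := by
    refine MemLp.integrable (q := 2) (by norm_num) ?_
    refine memLp_of_continuousOn_Ioo hφ.2.1 hφ.2.2 (hcv.mul (hφ.continuousOn_tau s)) fun x hx => ?_
    simp [tau, hφ.eq_zero hx, hφ.deriv_deriv_eq_zero hx]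
  have h2 : Integrable (fun x =>
      (-v'' x + (((s ^ 2 - 1 / 4) / Real.sin x ^ 2 : ℝ) : ℂ) * v x) * φ x) mu := by
    refine MemLp.integrable (q := 2) (by norm_num) ?_
    refine memLp_of_continuousOn_Ioo hφ.2.1 hφ.2.2
      ((hc.neg.add ((continuousOn_potential s).mul hcv)).mul hφc) fun x hx => ?_
    rw [hφ.eq_zero hx, mul_zero]
  rw [← sub_eq_zero, ← integral_sub h1 h2]
  -- the difference of the integrands is the derivative of the Wronskian
  have h3 := integral_deriv_eq_zero_of_compact (W := fun x => φ x * v' x - deriv φ x * v x)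
    (W' := fun x => φ x * v'' x - deriv (deriv φ) x * v x) hφ.2.1 hφ.2.2 (fun x hx => ?_)
    ((hφc.mul hc).sub (hφ.continuous_deriv_deriv.continuousOn.mul hcv)) (fun x hx => ?_)
    (fun x hx => ?_)
  · rw [← h3]
    congr 1
    funext x
    simp only [tau]
    ring
  · have := ((hφ.hasDerivAt x).mul (hv' x hx)).sub ((hφ.hasDerivAt_deriv x).mul (hv x hx))
    refine this.congr_deriv ?_
    ring
  · simp [hφ.eq_zero hx, hφ.deriv_eq_zero hx]
  · simp [hφ.eq_zero hx, hφ.deriv_deriv_eq_zero hx]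

/-- The first-order operator `A = d/dx - c cot x`. It annihilates `sin^c x`, and
`A* A = τ_s - c ^ 2` if `c = s + 1/2`. -/
noncomputable def ladder (c : ℝ) (φ : ℝ → ℂ) (x : ℝ) : ℂ :=
  deriv φ x - ((c * (Real.cos x / Real.sin x) : ℝ) : ℂ) * φ x

theorem continuousOn_cot (c : ℝ) :
    ContinuousOn (fun x : ℝ => ((c * (Real.cos x / Real.sin x) : ℝ) : ℂ)) (Ioo 0 Real.pi) := by
  refine Complex.continuous_ofReal.comp_continuousOn ?_
  exact continuousOn_const.mul (Real.continuous_cos.continuousOn.div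
    Real.continuous_sin.continuousOn fun x hx => (Real.sin_pos_of_mem_Ioo hx).ne')

theorem IsTestFunction.continuousOn_ladder {φ : ℝ → ℂ} (h : IsTestFunction φ) (c : ℝ) :
    ContinuousOn (ladder c φ) (Ioo 0 Real.pi) :=
  h.continuous_deriv.continuousOn.sub ((continuousOn_cot c).mul h.1.continuous.continuousOn)

theorem IsTestFunction.memLp_ladder {φ : ℝ → ℂ} (h : IsTestFunction φ) (c : ℝ) :
    MemLp (ladder c φ) 2 mu :=
  memLp_of_continuousOn_Ioo h.2.1 h.2.2 (h.continuousOn_ladder c) fun x hx => by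
    simp [ladder, h.eq_zero hx, h.deriv_eq_zero hx]

theorem ladder_sub (c : ℝ) {φ ψ : ℝ → ℂ} (hφ : IsTestFunction φ) (hψ : IsTestFunction ψ) :
    ladder c (φ - ψ) = ladder c φ - ladder c ψ := by
  funext x
  simp only [ladder, Pi.sub_apply, deriv_sub (hφ.hasDerivs.1 x) (hψ.hasDerivs.1 x)]
  ring

theorem hasDerivAt_cot {c x : ℝ} (hx : x ∈ Ioo 0 Real.pi) :
    HasDerivAt (fun x : ℝ => ((c * (Real.cos x / Real.sin x) : ℝ) : ℂ))
      ((-c / Real.sin x ^ 2 : ℝ) : ℂ) x := by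
  have hs := (Real.sin_pos_of_mem_Ioo hx).ne'
  refine HasDerivAt.ofReal_comp ?_
  convert! ((Real.hasDerivAt_cos x).div (Real.hasDerivAt_sin x) hs).const_mul c using 1
  field_simp
  linear_combination c * Real.sin_sq_add_cos_sq x

theorem hasDerivAt_conj {φ : ℝ → ℂ} {φ' : ℂ} {x : ℝ} (h : HasDerivAt φ φ' x) :
    HasDerivAt (fun y => (starRingEnd ℂ) (φ y)) ((starRingEnd ℂ) φ') x :=
  h.star

/-- The quadratic form of `τ_s` on test functions, from the factorization `τ_s = A* A + c ^ 2`. -/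
theorem integral_conj_mul_tau (s : ℝ) {φ : ℝ → ℂ} (hφ : IsTestFunction φ) :
    ∫ x, (starRingEnd ℂ) (φ x) * tau s φ x ∂mu =
      ((∫ x, ‖ladder (1 / 2 + s) φ x‖ ^ 2 ∂mu + (1 / 2 + s) ^ 2 * ∫ x, ‖φ x‖ ^ 2 ∂mu : ℝ) : ℂ) := by
  set c := 1 / 2 + s with hc
  have hφc := hφ.1.continuous.continuousOn (s := Ioo 0 Real.pi)
  have hφ'c := hφ.continuous_deriv.continuousOn (s := Ioo 0 Real.pi)
  have hφ''c := hφ.continuous_deriv_deriv.continuousOn (s := Ioo 0 Real.pi)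
  have hconj : ContinuousOn (fun x => (starRingEnd ℂ) (φ x)) (Ioo 0 Real.pi) :=
    Complex.continuous_conj.comp_continuousOn hφc
  have hconj' : ContinuousOn (fun x => (starRingEnd ℂ) (deriv φ x)) (Ioo 0 Real.pi) :=
    Complex.continuous_conj.comp_continuousOn hφ'c
  have h1 : Integrable (fun x => (starRingEnd ℂ) (φ x) * tau s φ x) mu := by
    refine MemLp.integrable (q := 2) (by norm_num) ?_
    refine memLp_of_continuousOn_Ioo hφ.2.1 hφ.2.2 (hconj.mul (hφ.continuousOn_tau s))
      fun x hx => ?_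
    simp [hφ.eq_zero hx]
  have h2 : Integrable (fun x => ‖ladder c φ x‖ ^ 2) mu :=
    (memLp_two_iff_integrable_sq_norm (hφ.memLp_ladder c).1).1 (hφ.memLp_ladder c)
  have h3 : Integrable (fun x => c ^ 2 * ‖φ x‖ ^ 2) mu :=
    ((memLp_two_iff_integrable_sq_norm hφ.memLp.1).1 hφ.memLp).const_mul _
  have h23 : Integrable (fun x => ((‖ladder c φ x‖ ^ 2 + c ^ 2 * ‖φ x‖ ^ 2 : ℝ) : ℂ)) mu :=
    (h2.add h3).ofReal
  rw [← integral_const_mul, ← integral_add h2 h3, ← integral_complex_ofReal, ← sub_eq_zero,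
    ← integral_sub h1 h23]
  have h4 := integral_deriv_eq_zero_of_compact
    (W := fun x => ((c * (Real.cos x / Real.sin x) : ℝ) : ℂ) * ((starRingEnd ℂ) (φ x) * φ x) -
      (starRingEnd ℂ) (φ x) * deriv φ x)
    (W' := fun x => (((-c / Real.sin x ^ 2 : ℝ) : ℂ) * ((starRingEnd ℂ) (φ x) * φ x) +
      ((c * (Real.cos x / Real.sin x) : ℝ) : ℂ) *
        ((starRingEnd ℂ) (deriv φ x) * φ x + (starRingEnd ℂ) (φ x) * deriv φ x)) -
      ((starRingEnd ℂ) (deriv φ x) * deriv φ x + (starRingEnd ℂ) (φ x) * deriv (deriv φ) x))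
    hφ.2.1 hφ.2.2 (fun x hx => ?_) ?_ (fun x hx => ?_) (fun x hx => ?_)
  · rw [← h4]
    refine integral_congr_ae ?_
    filter_upwards [ae_restrict_mem measurableSet_Ioo] with x hx
    have hs := (Real.sin_pos_of_mem_Ioo hx).ne'
    have hsC : Complex.sin x ≠ 0 := by exact_mod_cast hs
    have hn : ∀ z : ℂ, ((‖z‖ ^ 2 : ℝ) : ℂ) = (starRingEnd ℂ) z * z := fun z => by
      rw [← Complex.normSq_eq_norm_sq, Complex.normSq_eq_conj_mul_self]
    have htrig := Complex.cos_sq' (x : ℂ)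
    have hsc : s = c - 1 / 2 := by rw [hc]; ring
    simp only [tau, ladder, Complex.ofReal_add, Complex.ofReal_mul, hn, map_sub, map_mul,
      Complex.conj_ofReal, hsc]
    push_cast
    field_simp
    ring_nf
    rw [htrig]
    ring
  · have hc1 := hφ.hasDerivAt x
    have hc2 := hasDerivAt_conj hc1
    exact ((hasDerivAt_cot hx).mul (hc2.mul hc1)).sub (hc2.mul (hφ.hasDerivAt_deriv x))
  · refine ContinuousOn.sub (ContinuousOn.add (ContinuousOn.mul ?_ (hconj.mul hφc))
      ((continuousOn_cot c).mul ((hconj'.mul hφc).add (hconj.mul hφ'c))))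
      ((hconj'.mul hφ'c).add (hconj.mul hφ''c))
    refine Complex.continuous_ofReal.comp_continuousOn ?_
    exact continuousOn_const.div (by fun_prop) fun x hx =>
      pow_ne_zero _ (Real.sin_pos_of_mem_Ioo hx).ne'
  · simp [hφ.eq_zero hx]
  · simp [hφ.eq_zero hx, hφ.deriv_eq_zero hx]

/-! ### The preminimal operator -/

theorem L2_inner_eq {f g : L2} {F G : ℝ → ℂ} (hf : f =ᵐ[mu] F) (hg : g =ᵐ[mu] G) :
    inner ℂ f g = ∫ x, (starRingEnd ℂ) (F x) * G x ∂mu := by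
  rw [L2.inner_def]
  refine integral_congr_ae ?_
  filter_upwards [hf, hg] with x h1 h2
  rw [RCLike.inner_apply', h1, h2]

theorem L2_norm_sq_eq {f : L2} {F : ℝ → ℂ} (hf : f =ᵐ[mu] F) :
    ‖f‖ ^ 2 = ∫ x, ‖F x‖ ^ 2 ∂mu := by
  have h := L2_inner_eq hf hf
  rw [inner_self_eq_norm_sq_to_K] at h
  have h1 : ∀ x, (starRingEnd ℂ) (F x) * F x = ((‖F x‖ ^ 2 : ℝ) : ℂ) := fun x => by
    rw [← Complex.normSq_eq_norm_sq, Complex.normSq_eq_conj_mul_self]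
  simp only [h1, integral_complex_ofReal] at h
  refine Complex.ofReal_injective ?_
  rw [Complex.ofReal_pow]
  exact h

/-- An element of the domain is represented by a test function. -/
theorem exists_test_of_mem_domain {s : ℝ} (x : (preminimal s).domain) :
    ∃ φ, IsTestFunction φ ∧ (x : L2) =ᵐ[mu] φ ∧ preminimal s x =ᵐ[mu] tau s φ := by
  have h : ((x : L2), preminimal s x) ∈ (preminimal s).graph := LinearPMap.mem_graph _ x
  rw [graph_preminimal] at h
  exact h

/-- The operator acts as `τ_s` on any test function that represents the given element. -/
theorem mem_domain_of_test (s : ℝ) {φ : ℝ → ℂ} (hφ : IsTestFunction φ) {f : L2}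
    (hf : f =ᵐ[mu] φ) : ∃ h : f ∈ (preminimal s).domain, preminimal s ⟨f, h⟩ =ᵐ[mu] tau s φ := by
  have h : (f, (hφ.memLp_tau s).toLp) ∈ (preminimal s).graph := by
    rw [graph_preminimal]
    exact ⟨φ, hφ, hf, (hφ.memLp_tau s).coeFn_toLp⟩
  obtain ⟨⟨y, hy⟩, hy1, hy2⟩ := (LinearPMap.mem_graph_iff _).1 h
  subst hy1
  exact ⟨hy, by rw [hy2]; exact (hφ.memLp_tau s).coeFn_toLp⟩

theorem dense_domain_preminimal (s : ℝ) : Dense ((preminimal s).domain : Set L2) := by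
  rw [Submodule.dense_iff_topologicalClosure_eq_top, Submodule.topologicalClosure_eq_top_iff,
    Submodule.eq_bot_iff]
  intro f hf
  have hint : Integrable f mu := (Lp.memLp f).integrable (by norm_num)
  rw [Lp.eq_zero_iff_ae_eq_zero]
  have h := isOpen_Ioo.ae_eq_zero_of_integral_contDiff_smul_eq_zero (U := Ioo (0 : ℝ) Real.pi)
    (μ := mu) (f := f) (hint.locallyIntegrable.locallyIntegrableOn _) fun g hg hgc hgs => ?_
  · filter_upwards [h, ae_restrict_mem measurableSet_Ioo] with x h1 h2 using h1 h2
  · have ht : IsTestFunction fun x => (g x : ℂ) := by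
      refine ⟨Complex.ofRealCLM.contDiff.comp hg, hgc.comp_left Complex.ofReal_zero, ?_⟩
      exact (tsupport_comp_subset Complex.ofReal_zero g).trans hgs
    obtain ⟨h1, -⟩ := mem_domain_of_test s ht ht.memLp.coeFn_toLp
    have h2 := (Submodule.mem_orthogonal _ _).1 hf _ h1
    rw [L2_inner_eq ht.memLp.coeFn_toLp (ae_eq_refl _)] at h2
    simpa using h2

/-- The quadratic form of the preminimal operator in terms of `ladder`. -/
theorem inner_preminimal_self {s : ℝ} (x : (preminimal s).domain) {φ : ℝ → ℂ}
    (hφ : IsTestFunction φ) (hx : (x : L2) =ᵐ[mu] φ) :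
    inner ℂ (x : L2) (preminimal s x) =
      ((∫ t, ‖ladder (1 / 2 + s) φ t‖ ^ 2 ∂mu + (1 / 2 + s) ^ 2 * ‖(x : L2)‖ ^ 2 : ℝ) : ℂ) := by
  obtain ⟨h, h1⟩ := mem_domain_of_test s hφ hx
  rw [L2_inner_eq hx h1, integral_conj_mul_tau s hφ, L2_norm_sq_eq hx]

theorem isSemibounded_preminimal (s : ℝ) : IsSemibounded (preminimal s) := by
  refine ⟨dense_domain_preminimal s, fun x y => ?_, (1 / 2 + s) ^ 2, fun x => ?_⟩
  · obtain ⟨φ, hφ, hx, hTx⟩ := exists_test_of_mem_domain x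
    obtain ⟨ψ, hψ, hy, hTy⟩ := exists_test_of_mem_domain y
    rw [L2_inner_eq hTx hy, L2_inner_eq hx hTy,
      integral_mul_tau s hψ (fun t _ => hasDerivAt_conj (hφ.hasDerivAt t))
        (fun t _ => hasDerivAt_conj (hφ.hasDerivAt_deriv t))
        (Complex.continuous_conj.comp hφ.continuous_deriv_deriv).continuousOn]
    simp only [tau, map_add, map_neg, map_mul, Complex.conj_ofReal]
  · obtain ⟨φ, hφ, hx, -⟩ := exists_test_of_mem_domain x
    rw [inner_preminimal_self x hφ hx, Complex.ofReal_re]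
    have : 0 ≤ ∫ t, ‖ladder (1 / 2 + s) φ t‖ ^ 2 ∂mu := integral_nonneg fun t => by positivity
    linarith

/-! ### Gegenbauer polynomials -/

section Gegenbauer

open Polynomial

/-- The Gegenbauer operator `P ↦ (2c+1) X P' - (1 - X²) P''`. -/
noncomputable def gegenbauerOp (c : ℝ) : ℝ[X] →ₗ[ℝ] ℝ[X] :=
  (2 * c + 1) • (LinearMap.mulLeft ℝ X ∘ₗ derivative) -
    LinearMap.mulLeft ℝ (1 - X ^ 2) ∘ₗ derivative ∘ₗ derivative

theorem gegenbauerOp_apply (c : ℝ) (P : ℝ[X]) :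
    gegenbauerOp c P = (2 * c + 1) • (X * derivative P) -
      (1 - X ^ 2) * derivative (derivative P) := rfl

theorem gegenbauerOp_one (c : ℝ) : gegenbauerOp c 1 = 0 := by
  simp [gegenbauerOp_apply]

theorem gegenbauerOp_X (c : ℝ) : gegenbauerOp c X = (2 * c + 1) • X := by
  simp [gegenbauerOp_apply]

theorem gegenbauerOp_X_pow (c : ℝ) (m : ℕ) :
    gegenbauerOp c (X ^ (m + 2)) = (((m : ℝ) + 2) * (m + 2 + 2 * c)) • X ^ (m + 2) -
      (((m : ℝ) + 2) * (m + 1)) • X ^ m := by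
  simp only [gegenbauerOp_apply, derivative_X_pow, smul_eq_C_mul, derivative_mul, map_mul, map_add,
    derivative_natCast, map_natCast, map_ofNat, map_one, show m + 2 - 1 = m + 1 from rfl,
    Nat.add_sub_cancel]
  push_cast
  ring

/-- The Gegenbauer operator is triangular in the monomials, with diagonal entries
`m (m + 2c)`, so minus `n (n + 2c)` it is invertible on the polynomials of degree less than `n`. -/
theorem exists_gegenbauerOp_sub_eq (c : ℝ) (hc : 0 < c) (n : ℕ) : ∀ m < n, ∃ Q : ℝ[X],
    Q.degree ≤ m ∧ gegenbauerOp c Q - ((n : ℝ) * (n + 2 * c)) • Q = X ^ m := by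
  intro m
  induction m using Nat.strong_induction_on with
  | _ m ih =>
    intro hm
    have hne : (m : ℝ) * (m + 2 * c) - n * (n + 2 * c) ≠ 0 := by
      have h1 : (m : ℝ) < n := by exact_mod_cast hm
      have h2 : (0 : ℝ) ≤ m := by positivity
      nlinarith
    match m, ih, hm, hne with
    | 0, _, _, hne =>
      refine ⟨((0 : ℝ) * (0 + 2 * c) - n * (n + 2 * c))⁻¹ • 1, ?_, ?_⟩
      · exact (degree_smul_le _ _).trans (by simp)
      · rw [map_smul, gegenbauerOp_one, smul_zero, zero_sub, smul_smul, ← neg_smul, pow_zero]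
        convert one_smul ℝ (1 : ℝ[X]) using 2
        push_cast at hne
        field_simp [hne]
        ring
    | 1, _, _, hne =>
      refine ⟨((1 : ℝ) * (1 + 2 * c) - n * (n + 2 * c))⁻¹ • X, ?_, ?_⟩
      · exact (degree_smul_le _ _).trans (by simp)
      · rw [map_smul, gegenbauerOp_X, smul_smul, smul_smul, ← sub_smul, pow_one]
        convert one_smul ℝ (X : ℝ[X]) using 2
        push_cast at hne
        rw [mul_comm _ (2 * c + 1), ← sub_mul]
        convert mul_inv_cancel₀ hne using 2
        ring
    | m + 2, ih, hm, hne =>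
      obtain ⟨R, hR, hR'⟩ := ih m (by omega) (by omega)
      refine ⟨((((m + 2 : ℕ) : ℝ)) * ((m + 2 : ℕ) + 2 * c) - n * (n + 2 * c))⁻¹ •
        (X ^ (m + 2) + (((m : ℝ) + 2) * (m + 1)) • R), ?_, ?_⟩
      · refine (degree_smul_le _ _).trans
          ((degree_add_le _ _).trans (max_le (degree_X_pow_le _) ?_))
        refine (degree_smul_le _ _).trans (hR.trans ?_)
        exact_mod_cast Nat.le_add_right m 2
      · rw [map_smul, map_add, map_smul, gegenbauerOp_X_pow, sub_eq_iff_eq_add.1 hR',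
          smul_comm ((n : ℝ) * (n + 2 * c)), ← smul_sub, inv_smul_eq_iff₀ hne]
        simp only [smul_eq_C_mul]
        push_cast
        simp only [map_mul, map_add, map_sub, map_natCast, map_ofNat, map_one]
        ring

/-- The Gegenbauer polynomials, normalized to be monic: eigenvectors of `gegenbauerOp c`. -/
theorem exists_gegenbauer (c : ℝ) (hc : 0 < c) (n : ℕ) : ∃ P : ℝ[X],
    (P - X ^ n).degree < (n : WithBot ℕ) ∧ gegenbauerOp c P = ((n : ℝ) * (n + 2 * c)) • P := by
  match n with
  | 0 => exact ⟨1, by simp, by simp [gegenbauerOp_one]⟩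
  | 1 => exact ⟨X, by simp, by rw [gegenbauerOp_X]; push_cast; congr 1; ring⟩
  | m + 2 =>
    obtain ⟨Q, hQ, hQ'⟩ := exists_gegenbauerOp_sub_eq c hc (m + 2) m (by omega)
    refine ⟨X ^ (m + 2) + (((m : ℝ) + 2) * (m + 1)) • Q, ?_, ?_⟩
    · rw [add_sub_cancel_left]
      refine (degree_smul_le _ _).trans_lt (hQ.trans_lt ?_)
      exact_mod_cast (by omega : m < m + 2)
    · rw [map_add, map_smul, gegenbauerOp_X_pow, sub_eq_iff_eq_add.1 hQ']
      simp only [smul_eq_C_mul]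
      push_cast
      simp only [map_mul, map_add, map_natCast, map_ofNat, map_one]
      ring

/-- The monic Gegenbauer polynomial of degree `n`, for the weight `(1 - y²)^(c - 1/2)`. -/
noncomputable def gegenbauer (c : ℝ) (hc : 0 < c) (n : ℕ) : ℝ[X] :=
  (exists_gegenbauer c hc n).choose

variable {c : ℝ} (hc : 0 < c)

theorem degree_gegenbauer_sub_lt (n : ℕ) : (gegenbauer c hc n - X ^ n).degree < (n : WithBot ℕ) :=
  (exists_gegenbauer c hc n).choose_spec.1

theorem gegenbauerOp_gegenbauer (n : ℕ) :
    gegenbauerOp c (gegenbauer c hc n) = ((n : ℝ) * (n + 2 * c)) • gegenbauer c hc n :=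
  (exists_gegenbauer c hc n).choose_spec.2

theorem gegenbauer_ne_zero (n : ℕ) : gegenbauer c hc n ≠ 0 := by
  intro h
  have h1 := degree_gegenbauer_sub_lt hc n
  rw [h, zero_sub, degree_neg, degree_X_pow] at h1
  exact lt_irrefl _ h1

theorem span_gegenbauer : Submodule.span ℝ (range (gegenbauer c hc)) = ⊤ := by
  have hX : ∀ n, X ^ n ∈ Submodule.span ℝ (range (gegenbauer c hc)) := by
    intro n
    induction n using Nat.strong_induction_on with
    | _ n ih =>
      have h1 : (X : ℝ[X]) ^ n = gegenbauer c hc n - (gegenbauer c hc n - X ^ n) := by ring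
      rw [h1]
      refine Submodule.sub_mem _ (Submodule.subset_span ⟨n, rfl⟩) ?_
      rw [Polynomial.as_sum_support_C_mul_X_pow (gegenbauer c hc n - X ^ n)]
      refine Submodule.sum_mem _ fun k hk => ?_
      rw [← smul_eq_C_mul]
      refine Submodule.smul_mem _ _ (ih k ?_)
      exact_mod_cast (le_degree_of_mem_supp k hk).trans_lt (degree_gegenbauer_sub_lt hc n)
  refine eq_top_iff.2 fun P _ => ?_
  rw [Polynomial.as_sum_support_C_mul_X_pow P]
  refine Submodule.sum_mem _ fun k _ => ?_
  rw [← smul_eq_C_mul]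
  exact Submodule.smul_mem _ _ (hX k)

end Gegenbauer

/-! ### The eigenfunctions -/

section Eigenfunctions

open Polynomial

theorem memLp_of_continuous {g : ℝ → ℂ} (hg : Continuous g) : MemLp g 2 mu := by
  obtain ⟨C, hC⟩ := isCompact_Icc.exists_bound_of_continuousOn (s := Icc 0 Real.pi) hg.continuousOn
  refine MemLp.of_bound hg.aestronglyMeasurable C ?_
  filter_upwards [ae_restrict_mem measurableSet_Ioo] with x hx using hC x (Ioo_subset_Icc_self hx)

/-- The function `sin^c x · P(cos x)`. -/
noncomputable def sinPow (c : ℝ) (P : ℝ[X]) (x : ℝ) : ℝ := Real.sin x ^ c * P.eval (Real.cos x)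

theorem continuous_sinPow {c : ℝ} (hc : 0 ≤ c) (P : ℝ[X]) : Continuous (sinPow c P) :=
  (Real.continuous_sin.rpow_const fun _ => Or.inr hc).mul
    (P.continuous.comp Real.continuous_cos)

theorem memLp_sinPow {c : ℝ} (hc : 0 ≤ c) (P : ℝ[X]) : MemLp (fun x => (sinPow c P x : ℂ)) 2 mu :=
  memLp_of_continuous (Complex.continuous_ofReal.comp (continuous_sinPow hc P))

theorem hasDerivAt_sin_rpow_mul {c x r' : ℝ} {r : ℝ → ℝ} (hx : x ∈ Ioo 0 Real.pi)
    (hr : HasDerivAt r r' x) :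
    HasDerivAt (fun y => Real.sin y ^ c * r y)
      (Real.sin x ^ c * (c * (Real.cos x / Real.sin x) * r x + r')) x := by
  have hs := (Real.sin_pos_of_mem_Ioo hx).ne'
  have h := ((Real.hasDerivAt_sin x).rpow_const (p := c) (Or.inl hs)).mul hr
  rw [Real.rpow_sub_one hs] at h
  refine h.congr_deriv ?_
  field_simp

theorem hasDerivAt_eval_cos (P : ℝ[X]) (x : ℝ) :
    HasDerivAt (fun y => P.eval (Real.cos y))
      (-(Real.sin x * (derivative P).eval (Real.cos x))) x := by
  refine ((P.hasDerivAt (Real.cos x)).comp x (Real.hasDerivAt_cos x)).congr_deriv ?_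
  ring

/-- The derivative of `sinPow c P`. -/
noncomputable def sinPowDeriv (c : ℝ) (P : ℝ[X]) (x : ℝ) : ℝ :=
  Real.sin x ^ c * (c * (Real.cos x / Real.sin x) * P.eval (Real.cos x) -
    Real.sin x * (derivative P).eval (Real.cos x))

theorem hasDerivAt_sinPow (c : ℝ) (P : ℝ[X]) {x : ℝ} (hx : x ∈ Ioo 0 Real.pi) :
    HasDerivAt (sinPow c P) (sinPowDeriv c P x) x := by
  refine (hasDerivAt_sin_rpow_mul hx (hasDerivAt_eval_cos P x)).congr_deriv ?_
  rw [sinPowDeriv, ← sub_eq_add_neg]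

theorem continuousOn_sinPow (c : ℝ) (P : ℝ[X]) : ContinuousOn (sinPow c P) (Ioo 0 Real.pi) :=
  fun _ hx => (hasDerivAt_sinPow c P hx).continuousAt.continuousWithinAt

/-- The second derivative of `sinPow c P`, arranged so that `τ_s` maps `sinPow c P` to
`c ^ 2 * sinPow c P + sinPow c (gegenbauerOp c P)` if `c = 1/2 + s`. -/
theorem hasDerivAt_sinPowDeriv (c : ℝ) (P : ℝ[X]) {x : ℝ} (hx : x ∈ Ioo 0 Real.pi) :
    HasDerivAt (sinPowDeriv c P) ((c ^ 2 - c) / Real.sin x ^ 2 * sinPow c P x -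
      (c ^ 2 * sinPow c P x + sinPow c (gegenbauerOp c P) x)) x := by
  have hs := (Real.sin_pos_of_mem_Ioo hx).ne'
  have h1 := (((Real.hasDerivAt_cos x).div (Real.hasDerivAt_sin x) hs).const_mul c).mul
    (hasDerivAt_eval_cos P x)
  have h2 := (Real.hasDerivAt_sin x).mul (hasDerivAt_eval_cos (derivative P) x)
  refine (hasDerivAt_sin_rpow_mul (c := c) hx (h1.sub h2)).congr_deriv ?_
  have h3 : (gegenbauerOp c P).eval (Real.cos x) =
      (2 * c + 1) * (Real.cos x * (derivative P).eval (Real.cos x)) -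
        (1 - Real.cos x ^ 2) * (derivative (derivative P)).eval (Real.cos x) := by
    simp [gegenbauerOp_apply]
  simp only [sinPow, h3, Pi.mul_apply, Pi.sub_apply, Pi.div_apply]
  field_simp
  have h4 := Real.cos_sq' x
  ring_nf
  simp only [h4]
  ring

/-- `sin^c x · P(cos x)` is an eigenfunction of `τ_s` if `c = 1/2 + s` and `P` is an eigenvector of
the Gegenbauer operator. -/
theorem integral_sinPow_mul_tau (s κ : ℝ) {P : ℝ[X]}
    (hP : gegenbauerOp (1 / 2 + s) P = κ • P) {φ : ℝ → ℂ} (hφ : IsTestFunction φ) :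
    ∫ x, (sinPow (1 / 2 + s) P x : ℂ) * tau s φ x ∂mu =
      (((1 / 2 + s) ^ 2 + κ : ℝ) : ℂ) * ∫ x, (sinPow (1 / 2 + s) P x : ℂ) * φ x ∂mu := by
  have hcs := continuousOn_sinPow (1 / 2 + s) P
  rw [integral_mul_tau s hφ (fun x hx => (hasDerivAt_sinPow _ P hx).ofReal_comp)
    (fun x hx => (hasDerivAt_sinPowDeriv _ P hx).ofReal_comp), ← integral_const_mul]
  · congr 1
    funext x
    have h : sinPow (1 / 2 + s) (gegenbauerOp (1 / 2 + s) P) x = κ * sinPow (1 / 2 + s) P x := by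
      rw [hP, sinPow, sinPow, eval_smul, smul_eq_mul]
      ring
    rw [h, ← mul_assoc]
    congr 1
    push_cast
    ring
  · refine Complex.continuous_ofReal.comp_continuousOn ?_
    refine ((continuousOn_const.div (by fun_prop) fun x hx => ?_).mul hcs).sub
      ((continuousOn_const.mul hcs).add (continuousOn_sinPow _ _))
    exact pow_ne_zero _ (Real.sin_pos_of_mem_Ioo hx).ne'

/-- The functions `sin^c x · P(cos x)`, with `P` ranging over all polynomials, are total in
`L²((0,π))`. -/
theorem eq_zero_of_forall_integral_sinPow {c : ℝ} (hc : 0 ≤ c) (f : L2)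
    (hf : ∀ P : ℝ[X], ∫ x, (sinPow c P x : ℂ) * f x ∂mu = 0) : f = 0 := by
  have hcont : Continuous fun x => ((Real.sin x ^ c : ℝ) : ℂ) :=
    Complex.continuous_ofReal.comp (Real.continuous_sin.rpow_const fun _ => Or.inr hc)
  have hint : Integrable (fun x => ((Real.sin x ^ c : ℝ) : ℂ) * f x) mu :=
    MemLp.integrable_mul (memLp_of_continuous hcont) (Lp.memLp f)
  have h := isOpen_Ioo.ae_eq_zero_of_integral_contDiff_smul_eq_zero (U := Ioo (0 : ℝ) Real.pi)
    (μ := mu) (hint.locallyIntegrable.locallyIntegrableOn _) fun g hg _ _ => ?_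
  · rw [Lp.eq_zero_iff_ae_eq_zero]
    filter_upwards [h, ae_restrict_mem measurableSet_Ioo] with x h1 h2
    refine (mul_eq_zero.1 (h1 h2)).resolve_left ?_
    exact_mod_cast (Real.rpow_pos_of_pos (Real.sin_pos_of_mem_Ioo h2) c).ne'
  · -- approximate `g ∘ arccos` uniformly by polynomials
    set I := ∫ x, ‖((Real.sin x ^ c : ℝ) : ℂ) * f x‖ ∂mu with hI
    have hI0 : 0 ≤ I := integral_nonneg fun _ => norm_nonneg _
    refine norm_le_zero_iff.1 (le_of_forall_pos_le_add fun ε hε => ?_)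
    obtain ⟨P, hP⟩ := exists_polynomial_near_of_continuousOn (-1) 1 (fun y => g (Real.arccos y))
      (hg.continuous.comp Real.continuous_arccos).continuousOn (ε / (I + 1)) (by positivity)
    have hgint : Integrable (fun x => g x • (((Real.sin x ^ c : ℝ) : ℂ) * f x)) mu := by
      have h1 : MemLp (fun x => ((g x : ℂ) * ((Real.sin x ^ c : ℝ) : ℂ))) 2 mu :=
        memLp_of_continuous ((Complex.continuous_ofReal.comp hg.continuous).mul hcont)
      refine (MemLp.integrable_mul h1 (Lp.memLp f)).congr (Eventually.of_forall fun x => ?_)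
      simp [mul_assoc]
    have hPint : Integrable (fun x => (sinPow c P x : ℂ) * f x) mu :=
      MemLp.integrable_mul (memLp_sinPow hc P) (Lp.memLp f)
    have h1 : ∫ x, g x • (((Real.sin x ^ c : ℝ) : ℂ) * f x) ∂mu =
        ∫ x, (g x • (((Real.sin x ^ c : ℝ) : ℂ) * f x) - (sinPow c P x : ℂ) * f x) ∂mu := by
      rw [integral_sub hgint hPint, hf P, sub_zero]
    rw [h1, zero_add]
    calc _ ≤ ∫ x, ε / (I + 1) * ‖((Real.sin x ^ c : ℝ) : ℂ) * f x‖ ∂mu := by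
          refine norm_integral_le_of_norm_le (hint.norm.const_mul _) ?_
          filter_upwards [ae_restrict_mem measurableSet_Ioo] with x hx
          have h2 := hP (Real.cos x) ⟨Real.neg_one_le_cos x, Real.cos_le_one x⟩
          rw [Real.arccos_cos hx.1.le hx.2.le] at h2
          have h3 : g x • (((Real.sin x ^ c : ℝ) : ℂ) * f x) - (sinPow c P x : ℂ) * f x =
              ((g x - P.eval (Real.cos x) : ℝ) : ℂ) * (((Real.sin x ^ c : ℝ) : ℂ) * f x) := by
            rw [sinPow, Complex.real_smul]
            push_cast
            ring
          rw [h3, norm_mul, Complex.norm_real, Real.norm_eq_abs, abs_sub_comm]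
          gcongr
      _ = ε / (I + 1) * I := by rw [integral_const_mul]
      _ ≤ ε := by
          rw [div_mul_eq_mul_div, div_le_iff₀ (by positivity)]
          nlinarith

theorem toLp_sinPow_ne_zero {c : ℝ} (hc : 0 ≤ c) {P : ℝ[X]} (hP : P ≠ 0) :
    (memLp_sinPow hc P).toLp ≠ 0 := by
  intro h
  have h1 : (fun x => (sinPow c P x : ℂ)) =ᵐ[mu] fun _ => 0 := by
    refine (memLp_sinPow hc P).coeFn_toLp.symm.trans ?_
    rw [h]
    exact Lp.coeFn_zero _ _ _
  have h2 : EqOn (fun x => (sinPow c P x : ℂ)) (fun _ => 0) (Ioo 0 Real.pi) :=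
    Measure.eqOn_open_of_ae_eq h1 isOpen_Ioo
      (Complex.continuous_ofReal.comp (continuous_sinPow hc P)).continuousOn continuousOn_const
  refine hP (P.eq_zero_of_infinite_isRoot ?_)
  refine Infinite.mono ?_ ((Ioo_infinite Real.pi_pos).image
    (Real.injOn_cos.mono Ioo_subset_Icc_self))
  rintro _ ⟨x, hx, rfl⟩
  have h3 : sinPow c P x = 0 := Complex.ofReal_injective (h2 hx)
  exact (mul_eq_zero.1 h3).resolve_left (Real.rpow_pos_of_pos (Real.sin_pos_of_mem_Ioo hx) c).ne'

end Eigenfunctions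

/-! ### The eigenfunctions lie in the form domain -/

/-- A limit of test functions along which `d/dx - c cot x` converges in `L²` lies in the form domain
of the minimal operator. -/
theorem mem_formDomain_of_tendsto {s : ℝ} {f : L2} {F w : ℝ → ℂ} (hf : f =ᵐ[mu] F)
    (hw : MemLp w 2 mu) {φ : ℕ → ℝ → ℂ} (hφ : ∀ n, IsTestFunction (φ n))
    (h1 : Tendsto (fun n => ∫ x, ‖φ n x - F x‖ ^ 2 ∂mu) atTop (𝓝 0))
    (h2 : Tendsto (fun n => ∫ x, ‖ladder (1 / 2 + s) (φ n) x - w x‖ ^ 2 ∂mu) atTop (𝓝 0)) :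
    f ∈ formDomain (minimalOperator s) := by
  have hlim : ∀ {z : ℕ → L2} {z₀ : L2}, Tendsto (fun n => ‖z n - z₀‖ ^ 2) atTop (𝓝 0) →
      Tendsto z atTop (𝓝 z₀) := by
    intro z z₀ hz
    rw [tendsto_iff_norm_sub_tendsto_zero]
    simpa [Function.comp_def] using (Real.continuous_sqrt.tendsto 0).comp hz
  have hpair : ∀ {z : ℕ → L2} {z₀ : L2}, Tendsto z atTop (𝓝 z₀) →
      Tendsto (fun p : ℕ × ℕ => ‖z p.1 - z p.2‖ ^ 2) atTop (𝓝 0) := by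
    intro z z₀ hz
    rw [← prod_atTop_atTop_eq]
    have h := ((hz.comp tendsto_fst).sub (hz.comp tendsto_snd) :
      Tendsto _ ((atTop : Filter ℕ) ×ˢ (atTop : Filter ℕ)) _)
    simpa using h.norm.pow 2
  set x : ℕ → L2 := fun n => (hφ n).memLp.toLp with hx
  set a : ℕ → L2 := fun n => ((hφ n).memLp_ladder (1 / 2 + s)).toLp with ha
  have hxφ : ∀ n, x n =ᵐ[mu] φ n := fun n => (hφ n).memLp.coeFn_toLp
  have haφ : ∀ n, a n =ᵐ[mu] ladder (1 / 2 + s) (φ n) := fun n =>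
    ((hφ n).memLp_ladder (1 / 2 + s)).coeFn_toLp
  have hxlim : Tendsto x atTop (𝓝 f) := by
    refine hlim (h1.congr fun n => ?_)
    rw [L2_norm_sq_eq ((Lp.coeFn_sub _ _).trans ((hxφ n).sub hf))]
    rfl
  have halim : Tendsto a atTop (𝓝 hw.toLp) := by
    refine hlim (h2.congr fun n => ?_)
    rw [L2_norm_sq_eq ((Lp.coeFn_sub _ _).trans ((haφ n).sub hw.coeFn_toLp))]
    rfl
  have hmem : ∀ n, x n ∈ (preminimal s).domain := fun n => (mem_domain_of_test s (hφ n) (hxφ n)).1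
  have hle : preminimal s ≤ minimalOperator s := (preminimal s).le_closure
  refine ⟨fun n => ⟨x n, hle.1 (hmem n)⟩, hxlim, ?_⟩
  have hq : ∀ p : ℕ × ℕ, (inner ℂ (x p.1 - x p.2) (minimalOperator s
      (⟨x p.1, hle.1 (hmem p.1)⟩ - ⟨x p.2, hle.1 (hmem p.2)⟩))).re =
      ‖a p.1 - a p.2‖ ^ 2 + (1 / 2 + s) ^ 2 * ‖x p.1 - x p.2‖ ^ 2 := by
    intro p
    let y : (preminimal s).domain := ⟨x p.1, hmem p.1⟩ - ⟨x p.2, hmem p.2⟩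
    have h3 : minimalOperator s (⟨x p.1, hle.1 (hmem p.1)⟩ - ⟨x p.2, hle.1 (hmem p.2)⟩) =
        preminimal s y := (hle.2 rfl).symm
    have h4 : ((y : L2) : ℝ → ℂ) =ᵐ[mu] φ p.1 - φ p.2 :=
      (Lp.coeFn_sub _ _).trans ((hxφ p.1).sub (hxφ p.2))
    have h5 := inner_preminimal_self y ((hφ p.1).sub (hφ p.2)) h4
    rw [h3]
    change (inner ℂ (y : L2) (preminimal s y)).re = _
    rw [h5, Complex.ofReal_re, ladder_sub _ (hφ p.1) (hφ p.2),
      ← L2_norm_sq_eq ((Lp.coeFn_sub _ _).trans ((haφ p.1).sub (haφ p.2)))]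
    rfl
  have h3 := (hpair halim).add ((hpair hxlim).const_mul ((1 / 2 + s) ^ 2))
  simp only [mul_zero, add_zero] at h3
  exact h3.congr fun p => (hq p).symm

/-- A cutoff near the endpoints of `(0,π)`: it vanishes where `sin^ε x ≤ 1/3` and is `1` where
`sin^ε x ≥ 2/3`. -/
noncomputable def cutoff (ε x : ℝ) : ℝ := Real.smoothTransition (3 * Real.sin x ^ ε - 1)

theorem cutoff_nonneg (ε x : ℝ) : 0 ≤ cutoff ε x := Real.smoothTransition.nonneg _

theorem cutoff_le_one (ε x : ℝ) : cutoff ε x ≤ 1 := Real.smoothTransition.le_one _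

theorem continuous_cutoff {ε : ℝ} (hε : 0 ≤ ε) : Continuous (cutoff ε) :=
  Real.smoothTransition.continuous.comp
    ((continuous_const.mul (Real.continuous_sin.rpow_const fun _ => Or.inr hε)).sub
      continuous_const)

/-- The derivative of `cutoff ε`. -/
noncomputable def cutoffDeriv (ε x : ℝ) : ℝ :=
  deriv Real.smoothTransition (3 * Real.sin x ^ ε - 1) *
    (3 * (ε * (Real.sin x ^ ε * (Real.cos x / Real.sin x))))

theorem hasDerivAt_cutoff (ε : ℝ) {x : ℝ} (hx : x ∈ Ioo 0 Real.pi) :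
    HasDerivAt (cutoff ε) (cutoffDeriv ε x) x := by
  have hs := (Real.sin_pos_of_mem_Ioo hx).ne'
  have h1 := ((((Real.hasDerivAt_sin x).rpow_const (p := ε) (Or.inl hs)).const_mul 3).sub_const 1)
  have h2 : HasDerivAt Real.smoothTransition _ (3 * Real.sin x ^ ε - 1) :=
    ((Real.smoothTransition.contDiff (n := 1)).differentiable (by simp) _).hasDerivAt
  refine (h2.comp x h1).congr_deriv ?_
  rw [cutoffDeriv, Real.rpow_sub_one hs]
  ring

theorem exists_cutoffDeriv_bound : ∃ C : ℝ, ∀ ε, 0 ≤ ε → ∀ x ∈ Ioo 0 Real.pi,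
    |cutoffDeriv ε x| ≤ C * (ε * (Real.sin x ^ ε * (|Real.cos x| / Real.sin x))) := by
  have hc : Continuous (deriv Real.smoothTransition) :=
    (Real.smoothTransition.contDiff (n := 1)).continuous_deriv le_rfl
  obtain ⟨C, hC⟩ := (isCompact_Icc (a := (-1 : ℝ)) (b := 2)).exists_bound_of_continuousOn
    hc.continuousOn
  refine ⟨C * 3, fun ε hε x hx => ?_⟩
  have hs := Real.sin_pos_of_mem_Ioo hx
  have h0 : 0 ≤ Real.sin x ^ ε := Real.rpow_nonneg hs.le _
  have h1 : Real.sin x ^ ε ≤ 1 := Real.rpow_le_one hs.le (Real.sin_le_one x) hε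
  have h2 := hC (3 * Real.sin x ^ ε - 1) ⟨by linarith, by linarith⟩
  rw [Real.norm_eq_abs] at h2
  rw [cutoffDeriv, abs_mul, abs_mul, abs_mul, abs_mul, abs_div, abs_of_pos hs, abs_of_nonneg hε,
    abs_of_nonneg h0, abs_of_pos (by norm_num : (0 : ℝ) < 3), mul_assoc C]
  gcongr

theorem isTestFunction_indicator {g : ℝ → ℂ} {K : Set ℝ} (hK : IsCompact K)
    (hKs : K ⊆ Ioo 0 Real.pi) (hg : ∀ x ∈ Ioo 0 Real.pi, ContDiffAt ℝ ∞ g x)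
    (hgK : ∀ x ∈ Ioo 0 Real.pi, x ∉ K → g x = 0) :
    IsTestFunction ((Ioo 0 Real.pi).indicator g) := by
  have h0 : ∀ x ∉ K, (Ioo 0 Real.pi).indicator g x = 0 := by
    intro x hx
    by_cases hxI : x ∈ Ioo 0 Real.pi
    · rw [indicator_of_mem hxI, hgK x hxI hx]
    · exact indicator_of_notMem hxI _
  have hsupp : tsupport ((Ioo 0 Real.pi).indicator g) ⊆ K :=
    closure_minimal (fun x hx => by_contra fun h => hx (h0 x h)) hK.isClosed
  refine ⟨contDiff_iff_contDiffAt.2 fun x => ?_, HasCompactSupport.intro hK h0, hsupp.trans hKs⟩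
  by_cases hx : x ∈ K
  · refine (hg x (hKs hx)).congr_of_eventuallyEq ?_
    filter_upwards [isOpen_Ioo.mem_nhds (hKs hx)] with y hy using indicator_of_mem hy _
  · refine (contDiffAt_const (c := (0 : ℂ))).congr_of_eventuallyEq ?_
    filter_upwards [hK.isClosed.isOpen_compl.mem_nhds hx] with y hy using h0 y hy

open Polynomial in
/-- The function `sin^c x · P(cos x)`, cut off near the endpoints of `(0,π)`. -/
noncomputable def truncated (c : ℝ) (P : ℝ[X]) (ε : ℝ) : ℝ → ℂ :=
  (Ioo 0 Real.pi).indicator fun x => ((cutoff ε x * sinPow c P x : ℝ) : ℂ)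

section Truncation

open Polynomial

theorem isTestFunction_truncated (c : ℝ) (P : ℝ[X]) {ε : ℝ} (hε : 0 < ε) :
    IsTestFunction (truncated c P ε) := by
  have hcont : Continuous fun x => Real.sin x ^ ε :=
    Real.continuous_sin.rpow_const fun _ => Or.inr hε.le
  refine isTestFunction_indicator (K := Icc 0 Real.pi ∩ {x | 1 / 3 ≤ Real.sin x ^ ε})
    (isCompact_Icc.inter_right (isClosed_le continuous_const hcont)) ?_ (fun x hx => ?_)
    fun x hx hxK => ?_
  · rintro x ⟨hx, hx'⟩
    rw [mem_ofPred_eq] at hx'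
    refine ⟨lt_of_le_of_ne hx.1 ?_, lt_of_le_of_ne hx.2 ?_⟩
    · rintro rfl
      rw [Real.sin_zero, Real.zero_rpow hε.ne'] at hx'
      norm_num at hx'
    · rintro rfl
      rw [Real.sin_pi, Real.zero_rpow hε.ne'] at hx'
      norm_num at hx'
  · have hs := (Real.sin_pos_of_mem_Ioo hx).ne'
    have h1 : ∀ p : ℝ, ContDiffAt ℝ ∞ (fun x => Real.sin x ^ p) x := fun p =>
      Real.contDiff_sin.contDiffAt.rpow_const_of_ne hs
    have h2 : ContDiffAt ℝ ∞ (cutoff ε) x :=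
      Real.smoothTransition.contDiff.contDiffAt.comp x
        ((contDiffAt_const.mul (h1 ε)).sub contDiffAt_const)
    have hP : ContDiff ℝ ∞ fun y => P.eval y := by
      simpa [Polynomial.coe_aeval_eq_eval] using P.contDiff_aeval (𝕜 := ℝ) ∞
    have h3 : ContDiffAt ℝ ∞ (sinPow c P) x :=
      (h1 c).mul (hP.contDiffAt.comp x Real.contDiff_cos.contDiffAt)
    exact Complex.ofRealCLM.contDiff.contDiffAt.comp x (h2.mul h3)
  · have h1 : Real.sin x ^ ε < 1 / 3 := by
      by_contra! h
      exact hxK ⟨Ioo_subset_Icc_self hx, h⟩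
    rw [cutoff, Real.smoothTransition.zero_of_nonpos (by linarith), zero_mul, Complex.ofReal_zero]

/-- The term with the derivative of the cutoff is separate from the rest, which is bounded because
`d/dx - c cot x` maps `sin^c x · P(cos x)` to `-sin^(c+1) x · P'(cos x)`. -/
theorem ladder_truncated (c : ℝ) (P : ℝ[X]) (ε : ℝ) {x : ℝ} (hx : x ∈ Ioo 0 Real.pi) :
    ladder c (truncated c P ε) x = ((cutoffDeriv ε x * sinPow c P x -
      cutoff ε x * (Real.sin x * sinPow c (derivative P) x) : ℝ) : ℂ) := by
  have h1 : HasDerivAt (truncated c P ε)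
      ((cutoffDeriv ε x * sinPow c P x + cutoff ε x * sinPowDeriv c P x : ℝ) : ℂ) x := by
    refine HasDerivAt.congr_of_eventuallyEq
      ((hasDerivAt_cutoff ε hx).mul (hasDerivAt_sinPow c P hx)).ofReal_comp ?_
    filter_upwards [isOpen_Ioo.mem_nhds hx] with y hy using indicator_of_mem hy _
  rw [ladder, h1.deriv, truncated, indicator_of_mem hx, ← Complex.ofReal_mul, ← Complex.ofReal_sub]
  congr 1
  rw [sinPowDeriv, sinPow, sinPow]
  ring

end Truncation

/-- The weight that controls the derivative of the cutoff: with `α = 2ε`, its integral is `1/ε`. -/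
theorem integral_sin_rpow_mul_abs_cos {α : ℝ} (hα : 0 < α) :
    Integrable (fun x => Real.sin x ^ (α - 1) * |Real.cos x|) mu ∧
      ∫ x, Real.sin x ^ (α - 1) * |Real.cos x| ∂mu = 2 / α := by
  have hpi := Real.pi_pos
  set g : ℝ → ℝ := fun x => Real.sin x ^ (α - 1) * |Real.cos x| with hg
  set G : ℝ → ℝ := fun x => Real.sin x ^ α / α with hG
  have hGc : Continuous G := (Real.continuous_sin.rpow_const fun _ => Or.inr hα.le).div_const _
  have hd : ∀ x ∈ Ioo 0 Real.pi, HasDerivAt G (Real.sin x ^ (α - 1) * Real.cos x) x := by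
    intro x hx
    have hs := (Real.sin_pos_of_mem_Ioo hx).ne'
    refine (((Real.hasDerivAt_sin x).rpow_const (p := α) (Or.inl hs)).div_const α).congr_deriv ?_
    field_simp
  have hd1 : ∀ x ∈ Ioo 0 (Real.pi / 2), HasDerivAt G (g x) x := by
    intro x hx
    have hcos := Real.cos_pos_of_mem_Ioo (x := x) ⟨by linarith [hx.1], hx.2⟩
    rw [hg]
    simp only [abs_of_pos hcos]
    exact hd x ⟨hx.1, by linarith [hx.2]⟩
  have hd2 : ∀ x ∈ Ioo (Real.pi / 2) Real.pi, HasDerivAt (fun y => -G y) (g x) x := by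
    intro x hx
    have hcos := Real.cos_neg_of_pi_div_two_lt_of_lt (x := x) hx.1 (by linarith [hx.2])
    rw [hg]
    simp only [abs_of_neg hcos, mul_neg]
    exact (hd x ⟨by linarith [hx.1], hx.2⟩).neg
  have hpos : ∀ x ∈ Ioo 0 Real.pi, 0 ≤ g x := fun x hx =>
    mul_nonneg (Real.rpow_nonneg (Real.sin_pos_of_mem_Ioo hx).le _) (abs_nonneg _)
  have hi1 := intervalIntegral.integrableOn_deriv_of_nonneg hGc.continuousOn hd1
    fun x hx => hpos x ⟨hx.1, by linarith [hx.2]⟩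
  have hi2 := intervalIntegral.integrableOn_deriv_of_nonneg hGc.neg.continuousOn hd2
    fun x hx => hpos x ⟨by linarith [hx.1], hx.2⟩
  have hI1 := (intervalIntegrable_iff_integrableOn_Ioc_of_le (by linarith)).2 hi1
  have hI2 := (intervalIntegrable_iff_integrableOn_Ioc_of_le (by linarith)).2 hi2
  have hI := hI1.trans hI2
  constructor
  · exact ((intervalIntegrable_iff_integrableOn_Ioc_of_le hpi.le).1 hI).mono_set Ioo_subset_Ioc_self
  · rw [← integral_Ioc_eq_integral_Ioo, ← intervalIntegral.integral_of_le hpi.le,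
      ← intervalIntegral.integral_add_adjacent_intervals hI1 hI2,
      intervalIntegral.integral_eq_sub_of_hasDerivAt_of_le (by linarith) hGc.continuousOn hd1 hI1,
      intervalIntegral.integral_eq_sub_of_hasDerivAt_of_le (by linarith) hGc.neg.continuousOn hd2
        hI2]
    simp only [hG, Pi.neg_apply, Real.sin_pi_div_two, Real.sin_zero, Real.sin_pi,
      Real.zero_rpow hα.ne', Real.one_rpow]
    ring

theorem tendsto_cutoff {x : ℝ} (hx : x ∈ Ioo 0 Real.pi) :
    Tendsto (fun n : ℕ => cutoff (1 / ((n : ℝ) + 1)) x) atTop (𝓝 1) := by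
  have hs := Real.sin_pos_of_mem_Ioo hx
  have h1 : Tendsto (fun n : ℕ => Real.sin x ^ (1 / ((n : ℝ) + 1))) atTop (𝓝 1) := by
    have := (Real.continuousAt_const_rpow hs.ne' (b := 0)).tendsto.comp
      (tendsto_one_div_add_atTop_nhds_zero_nat (𝕜 := ℝ))
    simpa [Function.comp_def] using this
  have h2 : Tendsto (fun n : ℕ => cutoff (1 / ((n : ℝ) + 1)) x) atTop
      (𝓝 (Real.smoothTransition (3 * 1 - 1))) :=
    (Real.smoothTransition.continuous.tendsto _).comp ((h1.const_mul 3).sub_const 1)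
  rwa [Real.smoothTransition.one_of_one_le (by norm_num)] at h2

/-- Dominated convergence as `ε = 1 / (n + 1)` tends to zero. -/
theorem tendsto_integral_one_sub_cutoff {g : ℝ → ℝ} (hg : Continuous g) :
    Tendsto (fun n : ℕ => ∫ x, ((1 - cutoff (1 / ((n : ℝ) + 1)) x) * g x) ^ 2 ∂mu) atTop
      (𝓝 0) := by
  have h0 : ∫ x, ((1 - 1) * g x) ^ 2 ∂mu = 0 := by simp
  rw [← h0]
  have hgi : Integrable (fun x => g x ^ 2) mu :=
    (hg.pow 2).integrableOn_Icc.mono_set Ioo_subset_Icc_self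
  refine tendsto_integral_of_dominated_convergence (fun x => g x ^ 2) (fun n => ?_) hgi
    (fun n => ?_) ?_
  · exact (((continuous_const.sub (continuous_cutoff (by positivity))).mul hg).pow
      2).aestronglyMeasurable
  · refine Eventually.of_forall fun x => ?_
    have h1 := cutoff_nonneg (1 / ((n : ℝ) + 1)) x
    have h2 := cutoff_le_one (1 / ((n : ℝ) + 1)) x
    rw [Real.norm_eq_abs, abs_of_nonneg (sq_nonneg _), mul_pow]
    exact mul_le_of_le_one_left (sq_nonneg _) (by nlinarith)
  · filter_upwards [ae_restrict_mem measurableSet_Ioo] with x hx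
    exact ((((tendsto_cutoff hx).const_sub 1).mul_const _).pow 2)

open Polynomial in
/-- The contribution of the derivative of the cutoff is of order `ε`. -/
theorem exists_integral_cutoffDeriv_le {c : ℝ} (hc : 1 / 2 ≤ c) (P : ℝ[X]) :
    ∃ D : ℝ, ∀ ε, 0 < ε → Integrable (fun x => (cutoffDeriv ε x * sinPow c P x) ^ 2) mu ∧
      ∫ x, (cutoffDeriv ε x * sinPow c P x) ^ 2 ∂mu ≤ D * ε := by
  obtain ⟨C, hC⟩ := exists_cutoffDeriv_bound
  obtain ⟨B, hB⟩ := (isCompact_Icc (a := (-1 : ℝ)) (b := 1)).exists_bound_of_continuousOn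
    P.continuous.continuousOn
  refine ⟨(C * B) ^ 2, fun ε hε => ?_⟩
  obtain ⟨hint, hval⟩ := integral_sin_rpow_mul_abs_cos (α := 2 * ε) (by positivity)
  have hbound : ∀ x ∈ Ioo 0 Real.pi, (cutoffDeriv ε x * sinPow c P x) ^ 2 ≤
      (C * B) ^ 2 * ε ^ 2 * (Real.sin x ^ (2 * ε - 1) * |Real.cos x|) := by
    intro x hx
    have hs := Real.sin_pos_of_mem_Ioo hx
    have hP := hB (Real.cos x) ⟨Real.neg_one_le_cos x, Real.cos_le_one x⟩
    rw [Real.norm_eq_abs] at hP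
    -- here `c ≥ 1/2` is needed
    have hsc : (Real.sin x ^ c) ^ 2 ≤ Real.sin x := by
      rw [← Real.rpow_mul_natCast hs.le]
      calc _ ≤ Real.sin x ^ (1 : ℝ) :=
            Real.rpow_le_rpow_of_exponent_ge hs (Real.sin_le_one x) (by push_cast; linarith)
        _ = Real.sin x := Real.rpow_one _
    have hse : Real.sin x ^ (2 * ε - 1) = (Real.sin x ^ ε) ^ 2 / Real.sin x := by
      rw [Real.rpow_sub_one hs.ne', ← Real.rpow_mul_natCast hs.le]
      norm_num [mul_comm]
    have h1 : |cutoffDeriv ε x * sinPow c P x| ≤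
        (C * (ε * (Real.sin x ^ ε * (|Real.cos x| / Real.sin x)))) * (Real.sin x ^ c * B) := by
      rw [abs_mul]
      refine mul_le_mul (hC ε hε.le x hx) ?_ (abs_nonneg _) ((abs_nonneg _).trans (hC ε hε.le x hx))
      rw [sinPow, abs_mul, abs_of_nonneg (Real.rpow_nonneg hs.le c)]
      gcongr
    rw [← sq_abs]
    calc _ ≤ ((C * (ε * (Real.sin x ^ ε * (|Real.cos x| / Real.sin x)))) *
          (Real.sin x ^ c * B)) ^ 2 := by gcongr
      _ = (C * B) ^ 2 * ε ^ 2 * ((Real.sin x ^ ε) ^ 2 / Real.sin x *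
          (|Real.cos x| * |Real.cos x| * ((Real.sin x ^ c) ^ 2 / Real.sin x))) := by
          field_simp
      _ ≤ (C * B) ^ 2 * ε ^ 2 * ((Real.sin x ^ ε) ^ 2 / Real.sin x *
          (|Real.cos x| * 1 * 1)) := by
          gcongr
          · exact Real.abs_cos_le_one x
          · exact (div_le_one hs).2 hsc
      _ = _ := by rw [hse, mul_one, mul_one]
  have hcont : ContinuousOn (fun x => (cutoffDeriv ε x * sinPow c P x) ^ 2) (Ioo 0 Real.pi) := by
    have hd : Continuous (deriv Real.smoothTransition) :=
      (Real.smoothTransition.contDiff (n := 1)).continuous_deriv le_rfl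
    have hse : Continuous fun x => Real.sin x ^ ε :=
      Real.continuous_sin.rpow_const fun _ => Or.inr hε.le
    refine (ContinuousOn.mul ?_ (continuousOn_sinPow c P)).pow 2
    refine (hd.comp ((continuous_const.mul hse).sub continuous_const)).continuousOn.mul
      (continuousOn_const.mul (continuousOn_const.mul (hse.continuousOn.mul
        (Real.continuous_cos.continuousOn.div Real.continuous_sin.continuousOn fun x hx => ?_))))
    exact (Real.sin_pos_of_mem_Ioo hx).ne'
  have hint' := hint.const_mul ((C * B) ^ 2 * ε ^ 2)
  have hI : Integrable (fun x => (cutoffDeriv ε x * sinPow c P x) ^ 2) mu := by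
    refine hint'.mono' (hcont.aestronglyMeasurable measurableSet_Ioo) ?_
    filter_upwards [ae_restrict_mem measurableSet_Ioo] with x hx
    rw [Real.norm_eq_abs, abs_of_nonneg (sq_nonneg _)]
    exact hbound x hx
  refine ⟨hI, ?_⟩
  calc _ ≤ ∫ x, (C * B) ^ 2 * ε ^ 2 * (Real.sin x ^ (2 * ε - 1) * |Real.cos x|) ∂mu := by
        refine integral_mono_ae hI hint' ?_
        filter_upwards [ae_restrict_mem measurableSet_Ioo] with x hx using hbound x hx
    _ = (C * B) ^ 2 * ε := by
        rw [integral_const_mul, hval]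
        field_simp

open Polynomial in
/-- The functions `sin^c x · P(cos x)` are limits of their truncations in the form norm. -/
theorem sinPow_mem_formDomain {s : ℝ} (hs : 0 ≤ s) (P : ℝ[X]) {f : L2}
    (hf : f =ᵐ[mu] fun x => (sinPow (1 / 2 + s) P x : ℂ)) :
    f ∈ formDomain (minimalOperator s) := by
  have hc : 0 ≤ 1 / 2 + s := by positivity
  set c := 1 / 2 + s with hcs
  set w : ℝ → ℝ := fun x => Real.sin x * sinPow c (derivative P) x with hw
  have hwc : Continuous w := Real.continuous_sin.mul (continuous_sinPow hc _)
  have hε : ∀ n : ℕ, (0 : ℝ) < 1 / ((n : ℝ) + 1) := fun n => Nat.one_div_pos_of_nat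
  refine mem_formDomain_of_tendsto (w := fun x => ((-w x : ℝ) : ℂ))
    (φ := fun n => truncated c P (1 / ((n : ℝ) + 1))) hf
    (memLp_of_continuous (Complex.continuous_ofReal.comp hwc.neg))
    (fun n => isTestFunction_truncated c P (hε n)) ?_ ?_
  · refine (tendsto_integral_one_sub_cutoff (continuous_sinPow hc P)).congr fun n => ?_
    refine integral_congr_ae ?_
    filter_upwards [ae_restrict_mem measurableSet_Ioo] with x hx
    rw [truncated, indicator_of_mem hx, ← Complex.ofReal_sub, Complex.norm_real, Real.norm_eq_abs,
      sq_abs]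
    ring
  · obtain ⟨D, hD⟩ := exists_integral_cutoffDeriv_le (c := c) (by linarith) P
    have hlim : Tendsto (fun n : ℕ => 2 * (D * (1 / ((n : ℝ) + 1))) +
        2 * ∫ x, ((1 - cutoff (1 / ((n : ℝ) + 1)) x) * w x) ^ 2 ∂mu) atTop (𝓝 0) := by
      simpa using (((tendsto_one_div_add_atTop_nhds_zero_nat (𝕜 := ℝ)).const_mul D).const_mul 2).add
        ((tendsto_integral_one_sub_cutoff hwc).const_mul 2)
    refine squeeze_zero (fun n => integral_nonneg fun x => by positivity) (fun n => ?_) hlim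
    obtain ⟨hI, hle⟩ := hD _ (hε n)
    have hI2 : Integrable (fun x => ((1 - cutoff (1 / ((n : ℝ) + 1)) x) * w x) ^ 2) mu :=
      (((continuous_const.sub (continuous_cutoff (hε n).le)).mul
        hwc).pow 2).integrableOn_Icc.mono_set Ioo_subset_Icc_self
    calc _ ≤ ∫ x, (2 * (cutoffDeriv (1 / ((n : ℝ) + 1)) x * sinPow c P x) ^ 2 +
          2 * ((1 - cutoff (1 / ((n : ℝ) + 1)) x) * w x) ^ 2) ∂mu := by
          refine integral_mono_of_nonneg (Eventually.of_forall fun x => by positivity)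
            ((hI.const_mul 2).add (hI2.const_mul 2)) ?_
          filter_upwards [ae_restrict_mem measurableSet_Ioo] with x hx
          rw [ladder_truncated c P _ hx, ← Complex.ofReal_sub, Complex.norm_real, Real.norm_eq_abs,
            sq_abs]
          have := sq_nonneg (cutoffDeriv (1 / ((n : ℝ) + 1)) x * sinPow c P x -
            (1 - cutoff (1 / ((n : ℝ) + 1)) x) * w x)
          simp only [hw] at this ⊢
          linarith
      _ ≤ _ := by
          rw [integral_add (hI.const_mul 2) (hI2.const_mul 2), integral_const_mul,
            integral_const_mul]
          gcongr

/-! ### The eigenbasis of the Friedrichs operator -/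

section Eigenbasis

variable {s : ℝ} (hs : 0 ≤ s)

theorem isSemibounded_minimalOperator (s : ℝ) : IsSemibounded (minimalOperator s) :=
  (isSemibounded_preminimal s).closure

theorem half_add_pos (hs : 0 ≤ s) : 0 < 1 / 2 + s := by positivity

/-- The eigenfunction `sin^(1/2+s) x · P_n(cos x)`, with `P_n` the Gegenbauer polynomial, as an
element of `L²`. -/
noncomputable def eigenvector (hs : 0 ≤ s) (n : ℕ) : L2 :=
  (memLp_sinPow (half_add_pos hs).le (gegenbauer (1 / 2 + s) (half_add_pos hs) n)).toLp

theorem eigenvector_ae_eq (n : ℕ) : eigenvector hs n =ᵐ[mu]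
    fun x => (sinPow (1 / 2 + s) (gegenbauer (1 / 2 + s) (half_add_pos hs) n) x : ℂ) :=
  (memLp_sinPow (half_add_pos hs).le _).coeFn_toLp

theorem eigenvector_ne_zero (n : ℕ) : eigenvector hs n ≠ 0 :=
  toLp_sinPow_ne_zero (half_add_pos hs).le (gegenbauer_ne_zero _ n)

theorem friedrichsOperator_eigenvector (n : ℕ) :
    ∃ h : eigenvector hs n ∈ (friedrichsOperator s).domain,
      friedrichsOperator s ⟨eigenvector hs n, h⟩ =
        (((1 / 2 + s + (n : ℝ)) ^ 2 : ℝ) : ℂ) • eigenvector hs n := by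
  have hS := isSemibounded_minimalOperator s
  have hadj : ∀ x : (minimalOperator s).domain,
      inner ℂ ((((1 / 2 + s + (n : ℝ)) ^ 2 : ℝ) : ℂ) • eigenvector hs n) (x : L2) =
        inner ℂ (eigenvector hs n) (minimalOperator s x) := by
    refine (isSemibounded_preminimal s).inner_closure_eq fun x => ?_
    obtain ⟨φ, hφ, hx, hTx⟩ := exists_test_of_mem_domain x
    rw [inner_smul_left, Complex.conj_ofReal, L2_inner_eq (eigenvector_ae_eq hs n) hx,
      L2_inner_eq (eigenvector_ae_eq hs n) hTx]
    simp only [Complex.conj_ofReal]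
    rw [integral_sinPow_mul_tau s _ (gegenbauerOp_gegenbauer _ n) hφ]
    congr 2
    ring
  have hmem : eigenvector hs n ∈ (minimalOperator s).adjoint.domain :=
    LinearPMap.mem_adjoint_domain_of_exists _ ⟨_, hadj⟩
  refine ⟨(mem_domain_friedrichsExtension hS).2
    ⟨sinPow_mem_formDomain hs _ (eigenvector_ae_eq hs n), hmem⟩, ?_⟩
  refine (friedrichsExtension_apply _ ⟨eigenvector hs n, hmem⟩ rfl).trans ?_
  exact LinearPMap.adjoint_apply_eq hS.1 _ hadj

theorem eigenvalue_injective (hs : 0 ≤ s) :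
    Function.Injective fun n : ℕ => (1 / 2 + s + (n : ℝ)) ^ 2 := by
  intro m n h
  have h1 : 1 / 2 + s + (m : ℝ) = 1 / 2 + s + (n : ℝ) :=
    (sq_eq_sq₀ (by positivity) (by positivity)).1 h
  exact_mod_cast add_left_cancel h1

theorem tendsto_eigenvalue (s : ℝ) :
    Tendsto (fun n : ℕ => (1 / 2 + s + (n : ℝ)) ^ 2) atTop atTop :=
  (tendsto_pow_atTop two_ne_zero).comp
    (tendsto_atTop_add_const_left _ _ tendsto_natCast_atTop_atTop)

/-- The operator is symmetric and the eigenvalues are distinct. -/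
theorem inner_eigenvector {m n : ℕ} (hmn : m ≠ n) :
    inner ℂ (eigenvector hs m) (eigenvector hs n) = (0 : ℂ) := by
  obtain ⟨hm, hm'⟩ := friedrichsOperator_eigenvector hs m
  obtain ⟨hn, hn'⟩ := friedrichsOperator_eigenvector hs n
  have h := friedrichsExtension_isFormalAdjoint (isSemibounded_minimalOperator s)
    ⟨eigenvector hs m, hm⟩ ⟨eigenvector hs n, hn⟩
  change inner ℂ (friedrichsOperator s ⟨eigenvector hs m, hm⟩) (eigenvector hs n) =
    inner ℂ (eigenvector hs m) (friedrichsOperator s ⟨eigenvector hs n, hn⟩) at h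
  rw [hm', hn', inner_smul_left, inner_smul_right, Complex.conj_ofReal, ← sub_eq_zero,
    ← sub_mul] at h
  refine (mul_eq_zero.1 h).resolve_left fun h0 => hmn (eigenvalue_injective hs ?_)
  exact Complex.ofReal_injective (sub_eq_zero.1 h0)

theorem orthonormal_eigenvector :
    Orthonormal ℂ fun n => ((‖eigenvector hs n‖⁻¹ : ℝ) : ℂ) • eigenvector hs n := by
  refine ⟨fun n => ?_, fun m n hmn => ?_⟩
  · rw [norm_smul, Complex.norm_real, norm_inv, norm_norm,
      inv_mul_cancel₀ (norm_ne_zero_iff.2 (eigenvector_ne_zero hs n))]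
  · dsimp only
    rw [inner_smul_left, inner_smul_right, inner_eigenvector hs hmn, mul_zero, mul_zero]

open Polynomial in
theorem eq_zero_of_inner_eigenvector {f : L2} (hf : ∀ n, inner ℂ (eigenvector hs n) f = (0 : ℂ)) :
    f = 0 := by
  have hc := half_add_pos hs
  refine eq_zero_of_forall_integral_sinPow hc.le f fun P => ?_
  have hint : ∀ Q : ℝ[X], Integrable (fun x => (sinPow (1 / 2 + s) Q x : ℂ) * f x) mu := fun Q =>
    MemLp.integrable_mul (memLp_sinPow hc.le Q) (Lp.memLp f)
  have hP : P ∈ Submodule.span ℝ (range (gegenbauer (1 / 2 + s) hc)) := by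
    rw [span_gegenbauer]
    trivial
  induction hP using Submodule.span_induction with
  | mem Q hQ =>
    obtain ⟨n, rfl⟩ := hQ
    have h := hf n
    rw [L2_inner_eq (eigenvector_ae_eq hs n) (ae_eq_refl _)] at h
    simpa only [Complex.conj_ofReal] using h
  | zero => simp [sinPow]
  | add Q R _ _ hQ hR =>
    rw [← add_zero (0 : ℂ)]
    nth_rewrite 1 [← hQ]
    rw [← hR, ← integral_add (hint Q) (hint R)]
    congr 1
    funext x
    simp only [sinPow, eval_add]
    push_cast
    ring
  | smul a Q _ hQ =>
    rw [← mul_zero (a : ℂ), ← hQ, ← integral_const_mul]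
    congr 1
    funext x
    simp only [sinPow, eval_smul, smul_eq_mul]
    push_cast
    ring

/-- The Hilbert basis of normalized eigenfunctions. -/
noncomputable def eigenbasis (hs : 0 ≤ s) : HilbertBasis ℕ ℂ L2 :=
  HilbertBasis.mkOfOrthogonalEqBot (orthonormal_eigenvector hs) <| by
    rw [Submodule.eq_bot_iff]
    intro f hf
    refine eq_zero_of_inner_eigenvector hs fun n => ?_
    have h := (Submodule.mem_orthogonal _ _).1 hf _ (Submodule.subset_span ⟨n, rfl⟩)
    rw [inner_smul_left, mul_eq_zero] at h
    refine h.resolve_left ?_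
    rw [Complex.conj_ofReal]
    exact_mod_cast inv_ne_zero (norm_ne_zero_iff.2 (eigenvector_ne_zero hs n))

theorem isEigenbasis_eigenbasis : IsEigenbasis (friedrichsOperator s) (eigenbasis hs)
    fun n => (1 / 2 + s + (n : ℝ)) ^ 2 := by
  intro n
  rw [eigenbasis, HilbertBasis.coe_mkOfOrthogonalEqBot, ← mem_eigenspace_iff]
  exact Submodule.smul_mem _ _ (mem_eigenspace_iff.2 (friedrichsOperator_eigenvector hs n))

end Eigenbasis

end PoschlTeller

theorem mainTheorem3 (s : ℝ) (hs : 0 ≤ s) :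
    PoschlTeller.IsSemibounded (PoschlTeller.minimalOperator s) ∧
    IsSelfAdjoint (PoschlTeller.friedrichsOperator s) ∧
    PoschlTeller.spectrum (PoschlTeller.friedrichsOperator s) =
      {z : ℂ | ∃ n : ℕ, z = (((1 / 2 + s + (n : ℝ)) ^ 2 : ℝ) : ℂ)} ∧
    PoschlTeller.discreteSpectrum (PoschlTeller.friedrichsOperator s) =
      PoschlTeller.spectrum (PoschlTeller.friedrichsOperator s) ∧
    (∀ z ∈ PoschlTeller.spectrum (PoschlTeller.friedrichsOperator s),
      Module.finrank ℂ (PoschlTeller.eigenspace (PoschlTeller.friedrichsOperator s) z) = 1) ∧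
    IsGLB {x : ℝ | (x : ℂ) ∈ PoschlTeller.spectrum (PoschlTeller.friedrichsOperator s)}
      ((1 / 2 + s) ^ 2) := by
  have hS := PoschlTeller.isSemibounded_minimalOperator s
  have hb := PoschlTeller.isEigenbasis_eigenbasis hs
  have hT := PoschlTeller.friedrichsExtension_isFormalAdjoint hS
  have hcl : PoschlTeller.IsSeqClosedGraph (PoschlTeller.friedrichsOperator s) :=
    fun _ _ _ hF hTF => PoschlTeller.friedrichsExtension_isClosed hS hF hTF
  have hev := PoschlTeller.tendsto_eigenvalue s
  have hinj := PoschlTeller.eigenvalue_injective hs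
  have hspec : PoschlTeller.spectrum (PoschlTeller.friedrichsOperator s) =
      {z : ℂ | ∃ n : ℕ, z = (((1 / 2 + s + (n : ℝ)) ^ 2 : ℝ) : ℂ)} := by
    rw [hb.spectrum_eq hT hcl hev]
    ext z
    simp only [mem_range, mem_ofPred_eq, eq_comm]
  refine ⟨hS, hb.isSelfAdjoint hT hcl, hspec, hb.discreteSpectrum_eq hT hcl hev hinj, ?_,
    IsLeast.isGLB ⟨?_, ?_⟩⟩
  · rw [hspec]
    rintro _ ⟨n, rfl⟩
    exact hb.finrank_eigenspace hT hinj n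
  · rw [hspec]
    exact ⟨0, by simp⟩
  · rintro x hx
    rw [hspec] at hx
    obtain ⟨n, hn⟩ := hx
    rw [Complex.ofReal_injective hn]
    exact pow_le_pow_left₀ (by positivity) (le_add_of_nonneg_right (Nat.cast_nonneg n)) 2
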